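/- Let $A$ be an alphabet containing two distinct letters $a\neq b$. A synchronization tree over $A$ is a countable rooted tree with edges labelled in $A\cup\{\mathrm{ex}\}$, $\mathrm{ex}\notin A$, in which the target of every $\mathrm{ex}$-labelled edge is a leaf; morphisms preserve the root and the labelled edges. Let $0$ be the one-vertex tree and $1$ the tree with a single edge, labelled $\mathrm{ex}$; let $t+t'$ be the disjoint union of $t$ and $t'$ with the roots identified, and $t\cdot t'$ the tree obtained from $t$ by replacing each $\mathrm{ex}$-labelled edge with a copy of $t'$, its root identified with the source of that edge. A letter $c\in A$, as a constant, denotes the tree with one edge labelled $c$ followed by one edge labelled $\mathrm{ex}$; as a unary operation it is $c.t=c\cdot t$. The signature $\Gamma$ has $+,0,1$ and the letters as unary symbols; the signature $\Delta$ has $+,\cdot,0,1$ and the letters as constants. For $\Sigma\in\{\Gamma,\Delta\}$, a $\Sigma$-recursion scheme is a nonempty finite system of equations $F_i(v_1,\dots,v_{k_i})=t_i$, $1\le i\le n$, where $t_i$ is a term in the variables $v_1,\dots,v_{k_i}$ built from the symbols of $\Sigma$ and the function variables $F_1,\dots,F_n$ of ranks $k_1,\dots,k_n$; it is regular if all $k_i=0$.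 Its initial solution is the colimit of the $\omega$-chain of functors obtained by iterating the right-hand sides from the functors that are constantly the initial tree $0$. A tree is $\Sigma$-algebraic (respectively $\Sigma$-regular) if it is isomorphic to the first component of the initial solution of a $\Sigma$-recursion scheme (respectively of a regular one) with $k_1=0$. **Proposition.** The $\Gamma$-recursion scheme $$S=F(1+b.1),\qquad F(v)=v+a.F(1+b.v)$$ defines a $\Gamma$-algebraic synchronization tree over $A$ that is not bisimilar to any $\Delta$-regular synchronization tree over $A$. Moreover, the class of $\Delta$-regular trees over $A$ is strictly included in the class of $\Gamma$-algebraic trees over $A$, both up to bisimilarity and up to isomorphism: the trees bisimilar (respectively isomorphic) to some $\Delta$-regular tree form a proper subclass of the trees bisimilar (respectively isomorphic) to some $\Gamma$-algebraic tree. -/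

import Mathlib

open CategoryTheory CategoryTheory.Limits

universe u v w

namespace RecScheme

/-! ### Categorical algebras and recursion schemes over a ranked signature -/

/-- A ranked set of operation symbols. -/
structure Signature where
  Op : Type u
  arity : Op → ℕ

/-- A categorical algebra for `S`: a category with a functor `Cⁿ ⥤ C` for each symbol of rank `n`
and a distinguished initial object. -/
structure CatAlgebra (S : Signature.{u}) (C : Type v) [Category.{w} C] where
  op : ∀ σ : S.Op, (Fin (S.arity σ) → C) ⥤ C
  bot : C
  isInitial : IsInitial bot

/-- Terms over `S` and function variables `F_i` of rank `rank i`, in the variables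
`v_0, …, v_(m-1)`. -/
inductive Term (S : Signature.{u}) {n : ℕ} (rank : Fin n → ℕ) (m : ℕ) : Type u
  | var (i : Fin m) : Term S rank m
  | op (σ : S.Op) (ts : Fin (S.arity σ) → Term S rank m) : Term S rank m
  | app (i : Fin n) (ts : Fin (rank i) → Term S rank m) : Term S rank m

/-- A recursion scheme `F_i (v_0, …, v_(rank i - 1)) = rhs i`, for `i = 0, …, n`. -/
structure Scheme (S : Signature.{u}) where
  n : ℕ
  rank : Fin (n + 1) → ℕ
  rhs : ∀ i, Term S rank (rank i)

/-- A scheme is regular if all its function variables have rank `0`. -/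
def Scheme.Regular {S : Signature.{u}} (E : Scheme S) : Prop := ∀ i, E.rank i = 0

section Semantics

variable {S : Signature.{u}} {C : Type v} [Category.{w} C]

/-- The functor induced by a term, given an interpretation of the function variables. -/
def Term.functor (𝒜 : CatAlgebra S C) {n : ℕ} {rank : Fin n → ℕ} {m : ℕ}
    (f : ∀ i, (Fin (rank i) → C) ⥤ C) : Term S rank m → ((Fin m → C) ⥤ C)
  | .var i => Pi.eval (fun _ => C) i
  | .op σ ts => Functor.pi' (fun j => (ts j).functor 𝒜 f) ⋙ 𝒜.op σ
  | .app i ts => Functor.pi' (fun j => (ts j).functor 𝒜 f) ⋙ f i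

/-- The action of a term on natural transformations between interpretations of the function
variables. -/
def Term.natTrans (𝒜 : CatAlgebra S C) {n : ℕ} {rank : Fin n → ℕ} {m : ℕ}
    {f g : ∀ i, (Fin (rank i) → C) ⥤ C} (α : ∀ i, f i ⟶ g i) :
    ∀ t : Term S rank m, t.functor 𝒜 f ⟶ t.functor 𝒜 g
  | .var _ => 𝟙 _
  | .op σ ts =>
      (NatTrans.pi' (F := Functor.pi' fun j => (ts j).functor 𝒜 f)
        (G := Functor.pi' fun j => (ts j).functor 𝒜 g) fun j => (ts j).natTrans 𝒜 α) ◫ 𝟙 (𝒜.op σ)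
  | .app i ts =>
      (NatTrans.pi' (F := Functor.pi' fun j => (ts j).functor 𝒜 f)
        (G := Functor.pi' fun j => (ts j).functor 𝒜 g) fun j => (ts j).natTrans 𝒜 α) ◫ α i

/-- The approximations `g_0, g_1, …` of the initial solution: all components of `g_0` are constant
at the initial object, and `g_(i+1)` is obtained by evaluating the right-hand sides at `g_i`. -/
def Scheme.approx (𝒜 : CatAlgebra S C) (E : Scheme S) : ℕ → ∀ j, (Fin (E.rank j) → C) ⥤ C
  | 0 => fun _ => (Functor.const _).obj 𝒜.bot
  | i + 1 => fun j => (E.rhs j).functor 𝒜 (E.approx 𝒜 i)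

/-- The connecting natural transformations `g_i ⟶ g_(i+1)`. -/
def Scheme.approxMap (𝒜 : CatAlgebra S C) (E : Scheme S) :
    ∀ i j, E.approx 𝒜 i j ⟶ E.approx 𝒜 (i + 1) j
  | 0 => fun _ =>
      { app := fun _ => 𝒜.isInitial.to _
        naturality := fun _ _ _ => 𝒜.isInitial.hom_ext _ _ }
  | i + 1 => fun j => (E.rhs j).natTrans 𝒜 (E.approxMap 𝒜 i)

/-- The `ω`-diagram `g_0 ⟶ g_1 ⟶ …`, whose colimit is the initial solution of `E`. -/
def Scheme.diagram (𝒜 : CatAlgebra S C) (E : Scheme S) :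
    ℕ ⥤ (∀ j, (Fin (E.rank j) → C) ⥤ C) :=
  Functor.ofSequence (X := E.approx 𝒜) (E.approxMap 𝒜)

/-- When the first function variable has rank `0`, the `ω`-diagram in `C` that is the first
component of `E.diagram`, evaluated at the only object of `C⁰`. -/
def Scheme.objDiagram (𝒜 : CatAlgebra S C) (E : Scheme S) (h : E.rank 0 = 0) : ℕ ⥤ C :=
  E.diagram 𝒜 ⋙ Pi.eval (fun j => (Fin (E.rank j) → C) ⥤ C) 0 ⋙
    (evaluation (Fin (E.rank 0) → C) C).obj (fun i => (Fin.cast h i).elim0)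

/-- `E` defines the object `c`: the first function variable of `E` has rank `0`, and `c` is
isomorphic to the first component of the initial solution of `E` (colimits of functors being formed
pointwise). -/
def Scheme.Defines (𝒜 : CatAlgebra S C) (E : Scheme S) (c : C) : Prop :=
  ∃ h : E.rank 0 = 0, ∃ s : Cocone (E.objDiagram 𝒜 h), Nonempty (IsColimit s) ∧ Nonempty (c ≅ s.pt)

/-- Algebraic objects. -/
def IsAlgebraic (𝒜 : CatAlgebra S C) (c : C) : Prop := ∃ E : Scheme S, E.Defines 𝒜 c

/-- Regular objects. -/
def IsRegular (𝒜 : CatAlgebra S C) (c : C) : Prop :=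
  ∃ E : Scheme S, E.Regular ∧ E.Defines 𝒜 c

end Semantics

/-! ### Synchronization trees -/

/-- The quiver of a labelled edge relation. -/
abbrev edgeQuiver {V : Type} {L : Type u} (Edge : V → L → V → Prop) : Quiver V :=
  ⟨fun x y => {l : L // Edge x l y}⟩

/-- A synchronization tree over `A`. Labels are in `Option A`, and `none` is the exit label.
`Edge x l y` says that `(x, y)` is an edge with label `l`. For each vertex there is exactly one path
from the root; in particular two vertices are joined by at most one labelled edge. -/
structure SyncTree (A : Type u) where
  V : Type
  countable : Countable V
  root : V
  Edge : V → Option A → V → Prop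
  uniquePath : ∀ x : V, Nonempty (Unique (@Quiver.Path V (edgeQuiver Edge) root x))
  exit_leaf : ∀ {x y : V}, Edge x none y → ∀ l z, ¬ Edge y l z

theorem unique_path_of_parent {V : Type} {L : Type u} {Edge : V → L → V → Prop} {r : V}
    (root_in : ∀ x l, ¬ Edge x l r)
    (parent : ∀ {x l x' l' y}, Edge x l y → Edge x' l' y → x = x' ∧ l = l')
    (reach : ∀ x, Relation.ReflTransGen (fun x y => ∃ l, Edge x l y) r x) (x : V) :
    Nonempty (Unique (@Quiver.Path V (edgeQuiver Edge) r x)) := by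
  let _ : Quiver V := edgeQuiver Edge
  have ex : Nonempty (Quiver.Path r x) := by
    induction reach x with
    | refl => exact ⟨Quiver.Path.nil⟩
    | tail _ h ih =>
      obtain ⟨l, h⟩ := h
      obtain ⟨p⟩ := ih
      exact ⟨p.cons ⟨l, h⟩⟩
  have uni : ∀ {y : V} (p q : Quiver.Path r y), p = q := by
    intro y p
    induction p with
    | nil =>
      intro q
      cases q with
      | nil => rfl
      | cons q e => exact absurd e.2 (root_in _ _)
    | cons p e ih =>
      intro q
      cases q with
      | nil => exact absurd e.2 (root_in _ _)
      | cons q e' =>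
        obtain ⟨l, h⟩ := e
        obtain ⟨l', h'⟩ := e'
        obtain ⟨rfl, rfl⟩ := parent h h'
        rw [ih q]
  obtain ⟨p⟩ := ex
  exact ⟨⟨⟨p⟩, fun q => uni q p⟩⟩

namespace SyncTree

variable {A : Type u}

theorem root_in (t : SyncTree A) (x : t.V) (l : Option A) : ¬ t.Edge x l t.root := by
  intro h
  let _ : Quiver t.V := edgeQuiver t.Edge
  obtain ⟨hx⟩ := t.uniquePath x
  obtain ⟨hr⟩ := t.uniquePath t.root
  have := (hr.uniq (hx.default.cons ⟨l, h⟩)).trans (hr.uniq Quiver.Path.nil).symm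
  cases this

theorem parent (t : SyncTree A) {x l x' l' y} (h : t.Edge x l y) (h' : t.Edge x' l' y) :
    x = x' ∧ l = l' := by
  let _ : Quiver t.V := edgeQuiver t.Edge
  obtain ⟨hx⟩ := t.uniquePath x
  obtain ⟨hx'⟩ := t.uniquePath x'
  obtain ⟨hy⟩ := t.uniquePath y
  generalize hx.default = p at *
  generalize hx'.default = q at *
  have := (hy.uniq (p.cons ⟨l, h⟩)).trans (hy.uniq (q.cons ⟨l', h'⟩)).symm
  cases this
  exact ⟨rfl, rfl⟩

theorem reach (t : SyncTree A) (x : t.V) :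
    Relation.ReflTransGen (fun x y => ∃ l, t.Edge x l y) t.root x := by
  let _ : Quiver t.V := edgeQuiver t.Edge
  obtain ⟨hx⟩ := t.uniquePath x
  have : ∀ {y : t.V}, Quiver.Path t.root y →
      Relation.ReflTransGen (fun x y => ∃ l, t.Edge x l y) t.root y := by
    intro y p
    induction p with
    | nil => exact .refl
    | cons p e ih => exact ih.tail ⟨e.1, e.2⟩
  exact this hx.default

theorem exists_edge_of_ne_root (t : SyncTree A) {y : t.V} (h : y ≠ t.root) :
    ∃ x l, t.Edge x l y := by
  rcases (t.reach y).cases_tail with h' | ⟨x, _, l, e⟩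
  · exact absurd h' h
  · exact ⟨x, l, e⟩

/-- Morphisms preserve the root and the labelled edges. -/
@[ext]
structure Hom (t t' : SyncTree A) where
  toFun : t.V → t'.V
  map_root : toFun t.root = t'.root
  map_edge : ∀ {x l y}, t.Edge x l y → t'.Edge (toFun x) l (toFun y)

/-- The category of synchronization trees over `A`. -/
instance : Category.{0} (SyncTree A) where
  Hom := Hom
  id t := ⟨id, rfl, id⟩
  comp f g := ⟨g.toFun ∘ f.toFun, by simp [f.map_root, g.map_root], fun h => g.map_edge (f.map_edge h)⟩

@[ext]
theorem hom_ext {t t' : SyncTree A} {f g : t ⟶ t'} (h : Hom.toFun f = Hom.toFun g) : f = g :=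
  Hom.ext h

theorem Hom.map_ne_root {t t' : SyncTree A} (f : Hom t t') {x : t.V} (h : x ≠ t.root) :
    f.toFun x ≠ t'.root := by
  obtain ⟨y, l, e⟩ := t.exists_edge_of_ne_root h
  intro h'
  exact t'.root_in _ _ (h' ▸ f.map_edge e)

/-- `0`: a single vertex and no edges. -/
def zero (A : Type u) : SyncTree A where
  V := Unit
  countable := inferInstance
  root := ()
  Edge := fun _ _ _ => False
  uniquePath := unique_path_of_parent (fun _ _ h => h) (fun h _ => h.elim) (fun _ => .refl)
  exit_leaf := fun h => h.elim

/-- `1`: a single edge, with the exit label. -/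
def one (A : Type u) : SyncTree A where
  V := Bool
  countable := inferInstance
  root := false
  Edge := fun x l y => x = false ∧ l = none ∧ y = true
  uniquePath := unique_path_of_parent (by simp) (by rintro _ _ _ _ _ ⟨rfl, rfl, _⟩ ⟨rfl, rfl, _⟩; simp)
    (by
      rintro (_ | _)
      · exact .refl
      · exact .single ⟨none, rfl, rfl, rfl⟩)
  exit_leaf := by rintro _ _ ⟨rfl, _, rfl⟩; simp

/-- The tree with an edge labelled `a` from the root to a vertex `1` and an exit edge from `1`. -/
def letter (a : A) : SyncTree A where
  V := Fin 3
  countable := inferInstance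
  root := 0
  Edge := fun x l y => (x = 0 ∧ l = some a ∧ y = 1) ∨ (x = 1 ∧ l = none ∧ y = 2)
  uniquePath := unique_path_of_parent (by simp)
    (by
      rintro _ _ _ _ _ (⟨rfl, rfl, rfl⟩ | ⟨rfl, rfl, rfl⟩) (⟨rfl, rfl, h⟩ | ⟨rfl, rfl, h⟩) <;>
        simp_all)
    (by
      have h1 : Relation.ReflTransGen (fun x y : Fin 3 => ∃ l : Option A,
          (x = 0 ∧ l = some a ∧ y = 1) ∨ (x = 1 ∧ l = none ∧ y = 2)) 0 1 :=
        .single ⟨some a, Or.inl ⟨rfl, rfl, rfl⟩⟩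
      intro x
      fin_cases x
      · exact .refl
      · exact h1
      · exact h1.tail ⟨none, Or.inr ⟨rfl, rfl, rfl⟩⟩)
  exit_leaf := by
    rintro _ _ (⟨rfl, h, rfl⟩ | ⟨rfl, _, rfl⟩) l z
    · simp at h
    · simp

/-- The sum `t + s`: the union of `t` and `s` with the roots identified. The vertex `x` of `t` is
represented by `(x, root)`, and the vertex `y` of `s` by `(root, y)`. -/
def sum (t s : SyncTree A) : SyncTree A where
  V := {p : t.V × s.V // p.1 = t.root ∨ p.2 = s.root}
  countable := by
    have := t.countable
    have := s.countable
    infer_instance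
  root := ⟨(t.root, s.root), Or.inl rfl⟩
  Edge := fun p l q =>
    (t.Edge p.1.1 l q.1.1 ∧ p.1.2 = s.root ∧ q.1.2 = s.root) ∨
      (s.Edge p.1.2 l q.1.2 ∧ p.1.1 = t.root ∧ q.1.1 = t.root)
  uniquePath := unique_path_of_parent
    (by
      rintro x l (⟨h, _⟩ | ⟨h, _⟩)
      · exact t.root_in _ _ h
      · exact s.root_in _ _ h)
    (by
      rintro ⟨⟨x, x'⟩, hx⟩ l ⟨⟨y, y'⟩, hy⟩ l' ⟨⟨z, z'⟩, hz⟩ (⟨h, h1, h2⟩ | ⟨h, h1, h2⟩)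
        (⟨k, k1, k2⟩ | ⟨k, k1, k2⟩) <;> dsimp only at *
      · obtain ⟨rfl, rfl⟩ := t.parent h k
        subst h1 k1
        exact ⟨rfl, rfl⟩
      · exact absurd (k2 ▸ h) (t.root_in _ _)
      · exact absurd (h2 ▸ k) (t.root_in _ _)
      · obtain ⟨rfl, rfl⟩ := s.parent h k
        subst h1 k1
        exact ⟨rfl, rfl⟩)
    (by
      rintro ⟨⟨x, y⟩, hx | hy⟩
      · dsimp only at hx
        subst hx
        induction s.reach y with
        | refl => exact .refl
        | tail _ e ih =>
          obtain ⟨l, e⟩ := e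
          exact ih.tail ⟨l, Or.inr ⟨e, rfl, rfl⟩⟩
      · dsimp only at hy
        subst hy
        induction t.reach x with
        | refl => exact .refl
        | tail _ e ih =>
          obtain ⟨l, e⟩ := e
          exact ih.tail ⟨l, Or.inl ⟨e, rfl, rfl⟩⟩)
  exit_leaf := by
    rintro ⟨⟨x, x'⟩, hx⟩ ⟨⟨y, y'⟩, hy⟩ (⟨h, h1, h2⟩ | ⟨h, h1, h2⟩) l ⟨⟨z, z'⟩, hz⟩
      (⟨k, k1, k2⟩ | ⟨k, k1, k2⟩) <;> dsimp only at *
    · exact t.exit_leaf h _ _ k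
    · exact t.root_in _ _ (k1 ▸ h)
    · exact s.root_in _ _ (k1 ▸ h)
    · exact s.exit_leaf h _ _ k

/-- The sum of two morphisms acts as the first on `t` and as the second on `s`. -/
def sumMap {t t' s s' : SyncTree A} (f : t ⟶ t') (g : s ⟶ s') : sum t s ⟶ sum t' s' where
  toFun p := ⟨(Hom.toFun f p.1.1, Hom.toFun g p.1.2),
    p.2.imp (fun h => by simp only [h]; exact Hom.map_root f)
      (fun h => by simp only [h]; exact Hom.map_root g)⟩
  map_root := Subtype.ext (Prod.ext (Hom.map_root f) (Hom.map_root g))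
  map_edge := by
    rintro p l q (⟨h, h1, h2⟩ | ⟨h, h1, h2⟩)
    · exact Or.inl ⟨Hom.map_edge f h, by simp only [h1]; exact Hom.map_root g,
        by simp only [h2]; exact Hom.map_root g⟩
    · exact Or.inr ⟨Hom.map_edge g h, by simp only [h1]; exact Hom.map_root f,
        by simp only [h2]; exact Hom.map_root f⟩

/-- `x` is the target of an exit edge. -/
def IsExitTarget (t : SyncTree A) (x : t.V) : Prop := ∃ y, t.Edge y none x

theorem not_isExitTarget_of_edge {t : SyncTree A} {x l y} (h : t.Edge x l y) :
    ¬ t.IsExitTarget x :=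
  fun ⟨_, k⟩ => t.exit_leaf k _ _ h

theorem not_isExitTarget_root (t : SyncTree A) : ¬ t.IsExitTarget t.root :=
  fun ⟨_, k⟩ => t.root_in _ _ k

/-- The sequential product `t · s`: each exit edge of `t` is replaced by a copy of `s`, whose root is
identified with the source of the edge. A vertex `x` of `t` that is not the target of an exit edge is
represented by `(x, root)`; the non-root vertex `y` of the copy of `s` that replaces the exit edge
with target `x` is represented by `(x, y)`. -/
def prod (t s : SyncTree A) : SyncTree A where
  V := {p : t.V × s.V // t.IsExitTarget p.1 ↔ p.2 ≠ s.root}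
  countable := by
    have := t.countable
    have := s.countable
    infer_instance
  root := ⟨(t.root, s.root), iff_of_false t.not_isExitTarget_root (fun h => h rfl)⟩
  Edge := fun p l q =>
    (t.Edge p.1.1 l q.1.1 ∧ p.1.2 = s.root ∧ q.1.2 = s.root) ∨
      (t.Edge p.1.1 none q.1.1 ∧ p.1.2 = s.root ∧ s.Edge s.root l q.1.2) ∨
        (p.1.1 = q.1.1 ∧ s.Edge p.1.2 l q.1.2)
  uniquePath := unique_path_of_parent
    (by
      rintro x l (⟨h, _⟩ | ⟨_, _, h⟩ | ⟨_, h⟩)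
      · exact t.root_in _ _ h
      · exact s.root_in _ _ h
      · exact s.root_in _ _ h)
    (by
      rintro ⟨⟨x, x'⟩, hx⟩ l ⟨⟨y, y'⟩, hy⟩ l' ⟨⟨z, z'⟩, hz⟩ h k
      dsimp only at *
      rcases h with ⟨h, h1, h2⟩ | ⟨h, h1, h2⟩ | ⟨h1, h⟩ <;>
        rcases k with ⟨k, k1, k2⟩ | ⟨k, k1, k2⟩ | ⟨k1, k⟩
      · obtain ⟨rfl, rfl⟩ := t.parent h k
        subst h1 k1
        exact ⟨rfl, rfl⟩
      · exact absurd (h2 ▸ k2) (s.root_in _ _)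
      · exact absurd (h2 ▸ k) (s.root_in _ _)
      · exact absurd (k2 ▸ h2) (s.root_in _ _)
      · obtain ⟨rfl, -⟩ := t.parent h k
        obtain ⟨-, rfl⟩ := s.parent h2 k2
        subst h1 k1
        exact ⟨rfl, rfl⟩
      · obtain ⟨rfl, rfl⟩ := s.parent h2 k
        subst k1
        exact absurd rfl (hy.1 ⟨_, h⟩)
      · exact absurd (k2 ▸ h) (s.root_in _ _)
      · obtain ⟨rfl, rfl⟩ := s.parent h k2
        subst h1
        exact absurd rfl (hx.1 ⟨_, k⟩)
      · obtain ⟨rfl, rfl⟩ := s.parent h k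
        subst h1 k1
        exact ⟨rfl, rfl⟩)
    (by
      have key : ∀ x (hx : t.IsExitTarget x ↔ s.root ≠ s.root),
          Relation.ReflTransGen (fun p q : {p : t.V × s.V // t.IsExitTarget p.1 ↔ p.2 ≠ s.root} =>
            ∃ l, (t.Edge p.1.1 l q.1.1 ∧ p.1.2 = s.root ∧ q.1.2 = s.root) ∨
              (t.Edge p.1.1 none q.1.1 ∧ p.1.2 = s.root ∧ s.Edge s.root l q.1.2) ∨
                (p.1.1 = q.1.1 ∧ s.Edge p.1.2 l q.1.2))
          ⟨(t.root, s.root), iff_of_false t.not_isExitTarget_root (fun h => h rfl)⟩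
          ⟨(x, s.root), hx⟩ := by
        intro x
        induction t.reach x with
        | refl => intro _; exact .refl
        | tail _ e ih =>
          intro hx
          obtain ⟨l, e⟩ := e
          exact (ih (iff_of_false (not_isExitTarget_of_edge e) (fun h => h rfl))).tail
            ⟨l, Or.inl ⟨e, rfl, rfl⟩⟩
      rintro ⟨⟨x, y⟩, hp⟩
      by_cases hx : t.IsExitTarget x
      · obtain ⟨z, hz⟩ := hx
        have hz' := not_isExitTarget_of_edge hz
        induction s.reach y with
        | refl => exact absurd rfl (hp.1 ⟨z, hz⟩)
        | @tail y' y'' _ e ih =>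
          obtain ⟨l, e⟩ := e
          by_cases hy' : y' = s.root
          · subst hy'
            exact (key z (iff_of_false hz' (fun h => h rfl))).tail
              ⟨l, Or.inr (Or.inl ⟨hz, rfl, e⟩)⟩
          · exact (ih (iff_of_true ⟨z, hz⟩ hy')).tail ⟨l, Or.inr (Or.inr ⟨rfl, e⟩)⟩
      · have hy : y = s.root := by
          by_contra h
          exact hx (hp.2 h)
        subst hy
        exact key x hp)
  exit_leaf := by
    rintro ⟨⟨x, x'⟩, hx⟩ ⟨⟨y, y'⟩, hy⟩ h l ⟨⟨z, z'⟩, hz⟩ k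
    dsimp only at *
    have hy' : ∃ w, s.Edge w none y' := by
      rcases h with ⟨h, h1, h2⟩ | ⟨h, h1, h2⟩ | ⟨h1, h⟩
      · exact absurd h2 (hy.1 ⟨_, h⟩)
      · exact ⟨_, h2⟩
      · exact ⟨_, h⟩
    obtain ⟨w, hy'⟩ := hy'
    rcases k with ⟨k, k1, k2⟩ | ⟨k, k1, k2⟩ | ⟨k1, k⟩
    · exact s.root_in _ _ (k1 ▸ hy')
    · exact s.root_in _ _ (k1 ▸ hy')
    · exact s.exit_leaf hy' _ _ k

theorem Hom.isExitTarget_iff {t t' : SyncTree A} (f : Hom t t') (x : t.V) :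
    t'.IsExitTarget (f.toFun x) ↔ t.IsExitTarget x := by
  constructor
  · rintro ⟨y, hy⟩
    by_cases hx : x = t.root
    · subst hx
      rw [f.map_root] at hy
      exact absurd hy (t'.root_in _ _)
    · obtain ⟨z, l, e⟩ := t.exists_edge_of_ne_root hx
      obtain ⟨-, rfl⟩ := t'.parent hy (f.map_edge e)
      exact ⟨z, e⟩
  · rintro ⟨y, hy⟩
    exact ⟨_, f.map_edge hy⟩

theorem Hom.map_ne_root_iff {t t' : SyncTree A} (f : Hom t t') (x : t.V) :
    f.toFun x ≠ t'.root ↔ x ≠ t.root :=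
  ⟨fun h h' => h (h' ▸ f.map_root), f.map_ne_root⟩

/-- The product of two morphisms acts as the first on the vertices of `t` and as the second on each
copy of `s`. -/
def prodMap {t t' s s' : SyncTree A} (f : t ⟶ t') (g : s ⟶ s') : prod t s ⟶ prod t' s' where
  toFun p := ⟨(Hom.toFun f p.1.1, Hom.toFun g p.1.2),
    (Hom.isExitTarget_iff f _).trans (p.2.trans (Hom.map_ne_root_iff g _).symm)⟩
  map_root := Subtype.ext (Prod.ext (Hom.map_root f) (Hom.map_root g))
  map_edge := by
    have hg : ∀ {y : s.V}, y = s.root → Hom.toFun g y = s'.root := by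
      rintro _ rfl
      exact Hom.map_root g
    rintro p l q (⟨h, h1, h2⟩ | ⟨h, h1, h2⟩ | ⟨h1, h⟩)
    · exact Or.inl ⟨Hom.map_edge f h, hg h1, hg h2⟩
    · refine Or.inr (Or.inl ⟨Hom.map_edge f h, hg h1, ?_⟩)
      have := Hom.map_edge g h2
      rwa [Hom.map_root g] at this
    · exact Or.inr (Or.inr ⟨congrArg (Hom.toFun f) h1, Hom.map_edge g h⟩)

/-- The functor `+` of two variables. -/
def sumFunctor (A : Type u) : (Fin 2 → SyncTree A) ⥤ SyncTree A where
  obj x := sum (x 0) (x 1)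
  map f := sumMap (f 0) (f 1)

/-- The functor `·` of two variables. -/
def prodFunctor (A : Type u) : (Fin 2 → SyncTree A) ⥤ SyncTree A where
  obj x := prod (x 0) (x 1)
  map f := prodMap (f 0) (f 1)

/-- The prefixing functor `a(t) = a · t`. -/
def prefixFunctor (a : A) : (Fin 1 → SyncTree A) ⥤ SyncTree A where
  obj x := prod (letter a) (x 0)
  map f := prodMap (𝟙 (letter a)) (f 0)

/-- `0` is initial. -/
def zeroIsInitial (A : Type u) : IsInitial (zero A) :=
  IsInitial.ofUniqueHom
    (fun t => (⟨fun _ => t.root, rfl, fun h => h.elim⟩ : Hom (zero A) t))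
    (fun _ m => hom_ext (funext fun _ => Hom.map_root m))

/-- Two trees are bisimilar if some relation `R` between their vertices relates the roots and has
the transfer property in both directions. -/
def Bisimilar (t s : SyncTree A) : Prop :=
  ∃ R : t.V → s.V → Prop, R t.root s.root ∧
    (∀ x y, R x y → ∀ l x', t.Edge x l x' → ∃ y', s.Edge y l y' ∧ R x' y') ∧
    (∀ x y, R x y → ∀ l y', s.Edge y l y' → ∃ x', t.Edge x l x' ∧ R x' y')

end SyncTree

/-! ### The signatures `Γ` and `Δ` -/

/-- Symbols of `Γ`: binary `+`, constants `0` and `1`, a unary symbol for each letter. -/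
inductive GammaOp (A : Type u) : Type u
  | plus | zero | one
  | act (a : A)

/-- The signature `Γ`. -/
def Gamma (A : Type u) : Signature.{u} where
  Op := GammaOp A
  arity
    | .plus => 2
    | .zero => 0
    | .one => 0
    | .act _ => 1

/-- Symbols of `Δ`: binary `+` and `·`, constants `0` and `1`, a constant for each letter. -/
inductive DeltaOp (A : Type u) : Type u
  | plus | times | zero | one
  | letter (a : A)

/-- The signature `Δ`. -/
def Delta (A : Type u) : Signature.{u} where
  Op := DeltaOp A
  arity
    | .plus => 2
    | .times => 2
    | .zero => 0
    | .one => 0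
    | .letter _ => 0

/-- Synchronization trees as a `Γ`-algebra. -/
def gammaTrees (A : Type u) : CatAlgebra (Gamma A) (SyncTree A) where
  op
    | .plus => SyncTree.sumFunctor A
    | .zero => (Functor.const _).obj (SyncTree.zero A)
    | .one => (Functor.const _).obj (SyncTree.one A)
    | .act a => SyncTree.prefixFunctor a
  bot := SyncTree.zero A
  isInitial := SyncTree.zeroIsInitial A

/-- Synchronization trees as a `Δ`-algebra. -/
def deltaTrees (A : Type u) : CatAlgebra (Delta A) (SyncTree A) where
  op
    | .plus => SyncTree.sumFunctor A
    | .times => SyncTree.prodFunctor A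
    | .zero => (Functor.const _).obj (SyncTree.zero A)
    | .one => (Functor.const _).obj (SyncTree.one A)
    | .letter a => (Functor.const _).obj (SyncTree.letter a)
  bot := SyncTree.zero A
  isInitial := SyncTree.zeroIsInitial A

/-- `Γ`-algebraic trees. -/
def GammaAlgebraic {A : Type u} (t : SyncTree A) : Prop := IsAlgebraic (gammaTrees A) t

/-- `Δ`-regular trees. -/
def DeltaRegular {A : Type u} (t : SyncTree A) : Prop := IsRegular (deltaTrees A) t

section GammaTerms

variable {A : Type u} {n : ℕ} {rank : Fin n → ℕ} {m : ℕ}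

/-- The `Γ`-term `p + q`. -/
def gPlus (p q : Term (Gamma A) rank m) : Term (Gamma A) rank m :=
  .op (S := Gamma A) GammaOp.plus (fun i : Fin 2 => if i = 0 then p else q)

/-- The `Γ`-term `1`. -/
def gOne : Term (Gamma A) rank m :=
  .op (S := Gamma A) GammaOp.one (fun i : Fin 0 => i.elim0)

/-- The `Γ`-term `a.p`. -/
def gAct (a : A) (p : Term (Gamma A) rank m) : Term (Gamma A) rank m :=
  .op (S := Gamma A) (GammaOp.act a) (fun _ : Fin 1 => p)

end GammaTerms

/-- The scheme `S = F(1 + b.1)`, `F(v) = v + a.F(1 + b.v)`. -/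
def abScheme {A : Type u} (a b : A) : Scheme (Gamma A) where
  n := 1
  rank := fun i => i.val
  rhs
    | 0 => .app 1 fun _ => gPlus gOne (gAct b gOne)
    | 1 => gPlus (.var (0 : Fin 1)) (gAct a (.app 1 fun _ => gPlus gOne (gAct b (.var (0 : Fin 1)))))

end RecScheme

namespace RecScheme

/-! ### Regular schemes as chains of objects -/

section General

variable {S : Signature.{u}} {C : Type v} [Category.{w} C] (𝒜 : CatAlgebra S C)

/-! The tree of `abScheme` is, up to bisimulation, the unfolding of a deterministic transition
system that reads the words `aⁱbʲ` with `j ≤ i + 1` and may exit after each of them. State `up m`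
holds after `aᵐ`, and `down m` when exactly `m` further letters `b` can be read. In `F(v) = v +
a.F(1 + b.v)` the parameter counts: if `v` behaves as `down (m + 1)`, then `F(v)` behaves as `up m`,
and the recursive call is made on a tree behaving as `down (m + 2)`. This is shown for `k` steps at
the `k`-th approximation (`hasStateUpTo_approx`) and passes to the colimit by determinism
(`hasState_chainColimit`).

A Δ-regular tree cannot have state `up 0` at its root. If it did, it would have vertices in all
states `up m`. By `hasUpTerm`, each of these states occurs at the root of the value, in the initial
solution, of a subterm of the scheme. There are finitely many subterms, and a root is in at most one
state `up m`, a contradiction. To find the subterm, a vertex is traced through the operations. Sums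
are harmless and function variables are unfolded by their equations. The product is the crux:
`HasState.up_of_prodLeft` shows that a state `up m` at a vertex of `t` in `t · s` is already its
state in `t`, or else the state of the root of `s`.

For the inclusion, a regular Δ-scheme is rewritten in continuation-passing form. Each `F_i` becomes
a unary function variable standing for `v ↦ F_i · v`, and `Term.tr` pushes the continuation inwards
by right distributivity, associativity and the unit and zero laws. All isomorphisms must commute
with the connecting morphisms of the approximations, so that the two chains have the same colimit.
-/

theorem Term.natTrans_op_app {n : ℕ} {rank : Fin n → ℕ} {m : ℕ}
    {f g : ∀ i, (Fin (rank i) → C) ⥤ C} (α : ∀ i, f i ⟶ g i) (σ : S.Op)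
    (ts : Fin (S.arity σ) → Term S rank m) (x : Fin m → C) :
    ((Term.op σ ts).natTrans 𝒜 α).app x =
      (𝒜.op σ).map (X := fun j => ((ts j).functor 𝒜 f).obj x)
        (Y := fun j => ((ts j).functor 𝒜 g).obj x) (fun j => ((ts j).natTrans 𝒜 α).app x) :=
  Category.id_comp _

theorem Term.natTrans_app_app {n : ℕ} {rank : Fin n → ℕ} {m : ℕ}
    {f g : ∀ i, (Fin (rank i) → C) ⥤ C} (α : ∀ i, f i ⟶ g i) (i : Fin n)
    (ts : Fin (rank i) → Term S rank m) (x : Fin m → C) :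
    ((Term.app i ts).natTrans 𝒜 α).app x =
      (α i).app (fun j => ((ts j).functor 𝒜 f).obj x) ≫
        (g i).map (X := fun j => ((ts j).functor 𝒜 f).obj x)
          (Y := fun j => ((ts j).functor 𝒜 g).obj x) (fun j => ((ts j).natTrans 𝒜 α).app x) :=
  rfl

/-- The value of a closed term over function variables of rank `0`. -/
def Term.value {n : ℕ} (f : Fin n → C) : Term S (fun _ : Fin n => 0) 0 → C
  | .var i => i.elim0
  | .op σ ts => (𝒜.op σ).obj fun j => (ts j).value f
  | .app i _ => f i

/-- The action of a closed term over function variables of rank `0` on morphisms. -/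
def Term.valueMap {n : ℕ} {f g : Fin n → C} (α : ∀ i, f i ⟶ g i) :
    ∀ t : Term S (fun _ : Fin n => 0) 0, t.value 𝒜 f ⟶ t.value 𝒜 g
  | .var i => i.elim0
  | .op σ ts => (𝒜.op σ).map (X := fun j => (ts j).value 𝒜 f) (Y := fun j => (ts j).value 𝒜 g)
      fun j => (ts j).valueMap α
  | .app i _ => α i

theorem Term.valueMap_comp {n : ℕ} {f g h : Fin n → C} (α : ∀ i, f i ⟶ g i) (β : ∀ i, g i ⟶ h i)
    (t : Term S (fun _ : Fin n => 0) 0) :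
    t.valueMap 𝒜 α ≫ t.valueMap 𝒜 β = t.valueMap 𝒜 fun i => α i ≫ β i := by
  induction t with
  | var i => exact i.elim0
  | op σ ts ih =>
    refine ((𝒜.op σ).map_comp _ _).symm.trans (congrArg (𝒜.op σ).map ?_)
    funext j
    exact ih j
  | app i ts => rfl

/-- The category `C⁰` has one object and one morphism. Its objects are tuples that are equal only
propositionally, so the isomorphisms `e` are given for all of them. -/
theorem map_eq_of_rank_zero (F : (Fin 0 → C) ⥤ C) {c : C} (e : ∀ p, F.obj p ≅ c)
    {p q : Fin 0 → C} (u : p ⟶ q) : F.map u ≫ (e q).hom = (e p).hom := by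
  obtain rfl : p = q := Subsingleton.elim _ _
  obtain rfl : u = 𝟙 p := funext fun i => i.elim0
  simp

/-- The functor of a closed term over function variables of rank `0` is constant. -/
def Term.functorIso {n : ℕ} {F : ∀ _ : Fin n, (Fin 0 → C) ⥤ C} {f : Fin n → C}
    (e : ∀ i p, (F i).obj p ≅ f i) (x : Fin 0 → C) :
    ∀ t : Term S (fun _ : Fin n => 0) 0, (t.functor 𝒜 F).obj x ≅ t.value 𝒜 f
  | .var i => i.elim0
  | .op σ ts => (𝒜.op σ).mapIso (Pi.isoMk fun j => (ts j).functorIso e x)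
  | .app i _ => e i _

theorem Term.natTrans_functorIso {n : ℕ} {F G : ∀ _ : Fin n, (Fin 0 → C) ⥤ C} {f g : Fin n → C}
    (e : ∀ i p, (F i).obj p ≅ f i) (e' : ∀ i p, (G i).obj p ≅ g i)
    (α : ∀ i, F i ⟶ G i) (β : ∀ i, f i ⟶ g i)
    (h : ∀ i p, (α i).app p ≫ (e' i p).hom = (e i p).hom ≫ β i) (x : Fin 0 → C)
    (t : Term S (fun _ : Fin n => 0) 0) :
    (t.natTrans 𝒜 α).app x ≫ (t.functorIso 𝒜 e' x).hom =
      (t.functorIso 𝒜 e x).hom ≫ t.valueMap 𝒜 β := by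
  induction t with
  | var i => exact i.elim0
  | op σ ts ih =>
    rw [Term.natTrans_op_app]
    refine ((𝒜.op σ).map_comp _ _).symm.trans (Eq.trans ?_ ((𝒜.op σ).map_comp _ _))
    refine congrArg (𝒜.op σ).map ?_
    funext j
    exact ih j
  | app i ts =>
    refine (Category.assoc _ _ _).trans ?_
    refine Eq.trans (congrArg _ (map_eq_of_rank_zero (G i) (e' i) _)) (h i _)

variable {n : ℕ} (rhs : Fin (n + 1) → Term S (fun _ : Fin (n + 1) => 0) 0)

/-- The approximations of the initial solution of a regular scheme, as objects. -/
def regApprox : ℕ → Fin (n + 1) → C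
  | 0 => fun _ => 𝒜.bot
  | k + 1 => fun i => (rhs i).value 𝒜 (regApprox k)

/-- The connecting morphisms of `regApprox`. -/
def regApproxMap : ∀ k i, regApprox 𝒜 rhs k i ⟶ regApprox 𝒜 rhs (k + 1) i
  | 0 => fun _ => 𝒜.isInitial.to _
  | k + 1 => fun i => (rhs i).valueMap 𝒜 (regApproxMap k)

/-- The chain of the approximations of the component `i`. -/
abbrev regChain (i : Fin (n + 1)) : ℕ ⥤ C :=
  Functor.ofSequence (X := fun k => regApprox 𝒜 rhs k i) (fun k => regApproxMap 𝒜 rhs k i)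

/-- The approximations of a regular scheme are constant functors. -/
def approxIso : ∀ k i (p : Fin 0 → C),
    ((Scheme.mk n (fun _ => 0) rhs).approx 𝒜 k i).obj p ≅ regApprox 𝒜 rhs k i
  | 0 => fun _ _ => Iso.refl _
  | k + 1 => fun i p => (rhs i).functorIso 𝒜 (approxIso k) p

theorem approxMap_approxIso (k : ℕ) (i : Fin (n + 1)) (p : Fin 0 → C) :
    ((Scheme.mk n (fun _ => 0) rhs).approxMap 𝒜 k i).app p ≫ (approxIso 𝒜 rhs (k + 1) i p).hom =
      (approxIso 𝒜 rhs k i p).hom ≫ regApproxMap 𝒜 rhs k i := by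
  induction k generalizing i p with
  | zero => exact 𝒜.isInitial.hom_ext _ _
  | succ k ih => exact Term.natTrans_functorIso 𝒜 _ _ _ _ ih p (rhs i)

theorem diagram_map_succ (E : Scheme S) (k : ℕ) (h : k ≤ k + 1) :
    (E.diagram 𝒜).map (homOfLE h) = E.approxMap 𝒜 k :=
  Functor.ofSequence_map_homOfLE_succ _ _

theorem objDiagram_map_succ (E : Scheme S) (h : E.rank 0 = 0) (k : ℕ) (hk : k ≤ k + 1) :
    (E.objDiagram 𝒜 h).map (homOfLE hk) = (E.approxMap 𝒜 k 0).app _ :=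
  congrArg (fun α : E.approx 𝒜 k ⟶ E.approx 𝒜 (k + 1) => (α 0).app _) (diagram_map_succ 𝒜 E k hk)

/-- The diagram of a regular scheme as a chain of objects. -/
def objDiagramIso (h : (Scheme.mk n (fun _ => 0) rhs).rank 0 = 0) :
    (Scheme.mk n (fun _ => 0) rhs).objDiagram 𝒜 h ≅ regChain 𝒜 rhs 0 :=
  NatIso.ofComponents (fun k => approxIso 𝒜 rhs k 0 _) (by
    intro k l f
    -- For functors on `ℕ`, naturality need only be checked on the arrows `k ⟶ k + 1`.
    refine (NatTrans.ofSequence (F := (Scheme.mk n (fun _ => 0) rhs).objDiagram 𝒜 h)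
      (G := regChain 𝒜 rhs 0) (fun k => (approxIso 𝒜 rhs k 0 _).hom) ?_).naturality f
    intro k
    rw [Functor.ofSequence_map_homOfLE_succ]
    refine Eq.trans ?_ (approxMap_approxIso 𝒜 rhs k 0 _)
    exact congrArg (· ≫ _) (objDiagram_map_succ 𝒜 _ h k _))

/-- A regular object is the colimit of the approximations of a system of closed terms. -/
theorem IsRegular.exists_regChain {c : C} (hc : IsRegular 𝒜 c) :
    ∃ (n : ℕ) (rhs : Fin (n + 1) → Term S (fun _ : Fin (n + 1) => 0) 0)
      (s : Cocone (regChain 𝒜 rhs 0)), Nonempty (IsColimit s) ∧ Nonempty (c ≅ s.pt) := by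
  obtain ⟨⟨n, rank, rhs⟩, hr, h, s, ⟨hs⟩, e⟩ := hc
  obtain rfl : rank = fun _ => 0 := funext hr
  exact ⟨n, rhs, _, ⟨(IsColimit.precomposeInvEquiv (objDiagramIso 𝒜 rhs h) s).symm hs⟩, e⟩

end General

/-! ### Colimits of shifted chains -/

section Shift

variable {C : Type v} [Category.{w} C]

/-- If the chain `K'` is, up to isomorphism, the chain `K` with an object added in front, then a
colimit of `K` is a colimit of `K'`. -/
theorem exists_isColimit_of_shift {K K' : ℕ ⥤ C} (φ : ∀ k, K'.obj (k + 1) ≅ K.obj k)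
    (hφ : ∀ k, K'.map (homOfLE (Nat.le_succ (k + 1))) ≫ (φ (k + 1)).hom =
      (φ k).hom ≫ K.map (homOfLE (Nat.le_succ k)))
    {s : Cocone K} (hs : IsColimit s) :
    ∃ s' : Cocone K', Nonempty (IsColimit s') ∧ s'.pt = s.pt := by
  -- The leg at `k` first moves to index `k + 1`, where `K'` is identified with `K`; nothing is
  -- needed about `K'.obj 0`.
  let ι : ∀ k, K'.obj k ⟶ s.pt := fun k =>
    K'.map (homOfLE (Nat.le_succ k)) ≫ (φ k).hom ≫ s.ι.app k
  have hι : ∀ k, ι (k + 1) = (φ k).hom ≫ s.ι.app k := by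
    intro k
    have := s.w (homOfLE (Nat.le_succ k))
    simp only [ι]
    rw [← Category.assoc, hφ, Category.assoc, this]
  let s' : Cocone K' :=
    { pt := s.pt
      ι := NatTrans.ofSequence (G := (Functor.const ℕ).obj s.pt) ι (fun k => by
        rw [hι]; simp [ι]) }
  have key : ∀ r : Cocone K', ∀ k, K.map (homOfLE (Nat.le_succ k)) ≫ (φ (k + 1)).inv ≫ r.ι.app (k + 2) =
      (φ k).inv ≫ r.ι.app (k + 1) := by
    intro r k
    rw [← r.w (homOfLE (Nat.le_succ (k + 1))), ← Category.assoc, ← Category.assoc]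
    congr 1
    rw [Iso.comp_inv_eq, Category.assoc, hφ, Iso.inv_hom_id_assoc]
  -- Forgetting the leg at `0` turns a cocone on `K'` into a cocone on `K`.
  let d : Cocone K' → Cocone K := fun r =>
    { pt := r.pt
      ι := NatTrans.ofSequence (G := (Functor.const ℕ).obj r.pt)
        (fun k => (φ k).inv ≫ r.ι.app (k + 1)) (fun k => by
          rw [key]; simp) }
  refine ⟨s', ⟨?_⟩, rfl⟩
  refine
    { desc := fun r => hs.desc (d r)
      fac := ?_
      uniq := ?_ }
  · intro r k
    have h1 : s.ι.app k ≫ hs.desc (d r) = (φ k).inv ≫ r.ι.app (k + 1) := hs.fac (d r) k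
    change ι k ≫ _ = _
    simp only [ι, Category.assoc]
    rw [h1, Iso.hom_inv_id_assoc, r.w]
  · intro r m hm
    refine hs.uniq (d r) m fun k => ?_
    have h1 : ι (k + 1) ≫ m = r.ι.app (k + 1) := hm (k + 1)
    rw [hι, Category.assoc] at h1
    exact (Iso.eq_inv_comp _).2 h1

end Shift

namespace SyncTree

variable {A : Type u}

@[simp]
theorem comp_toFun {t t' t'' : SyncTree A} (f : t ⟶ t') (g : t' ⟶ t'') (x : t.V) :
    Hom.toFun (f ≫ g) x = Hom.toFun g (Hom.toFun f x) := rfl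

@[simp]
theorem id_toFun (t : SyncTree A) (x : t.V) : Hom.toFun (𝟙 t) x = x := rfl

/-- An edge in the image of a morphism whose source is any vertex lifts from its target. -/
theorem Hom.exists_edge_lift {t t' : SyncTree A} (f : Hom t t') {x' l} {y : t.V}
    (h : t'.Edge x' l (f.toFun y)) : ∃ x, t.Edge x l y ∧ f.toFun x = x' := by
  have hy : y ≠ t.root := by
    rintro rfl
    rw [f.map_root] at h
    exact t'.root_in _ _ h
  obtain ⟨x, l', e⟩ := t.exists_edge_of_ne_root hy
  obtain ⟨h1, rfl⟩ := t'.parent h (f.map_edge e)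
  exact ⟨x, e, h1.symm⟩

/-! ### Colimits of ω-chains of synchronization trees -/

section Colimit

variable (K : ℕ ⥤ SyncTree A)

/-- The maps on vertices of a chain of trees. -/
def trans {k l : ℕ} (h : k ≤ l) : (K.obj k).V → (K.obj l).V := Hom.toFun (K.map (homOfLE h))

theorem trans_refl {k : ℕ} (h : k ≤ k) (x : (K.obj k).V) : trans K h x = x := by
  have : K.map (homOfLE h) = 𝟙 _ := K.map_id k
  rw [trans, this, id_toFun]

theorem trans_trans {k l m : ℕ} (h : k ≤ l) (h' : l ≤ m) (x : (K.obj k).V) :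
    trans K h' (trans K h x) = trans K (h.trans h') x := by
  rw [trans, trans, ← comp_toFun, ← K.map_comp]
  rfl

theorem trans_root {k l : ℕ} (h : k ≤ l) : trans K h (K.obj k).root = (K.obj l).root :=
  Hom.map_root _

variable {K} in
theorem trans_edge {k l : ℕ} (h : k ≤ l) {x a y} (e : (K.obj k).Edge x a y) :
    (K.obj l).Edge (trans K h x) a (trans K h y) :=
  Hom.map_edge _ e

/-- Vertices of the trees of a chain are identified if they become equal. -/
def chainSetoid : Setoid (Σ k, (K.obj k).V) where
  r p q := ∃ m, ∃ (h : p.1 ≤ m) (h' : q.1 ≤ m), trans K h p.2 = trans K h' q.2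
  iseqv :=
    { refl := fun p => ⟨p.1, le_rfl, le_rfl, rfl⟩
      symm := fun ⟨m, h, h', e⟩ => ⟨m, h', h, e.symm⟩
      trans := by
        rintro p q r ⟨m, h, h', e⟩ ⟨m', k, k', e'⟩
        refine ⟨max m m', h.trans (le_max_left _ _), k'.trans (le_max_right _ _), ?_⟩
        rw [← trans_trans K h (le_max_left _ _), e, ← trans_trans K k' (le_max_right _ _), ← e',
          trans_trans, trans_trans] }

/-- The class of a vertex. -/
def chainMk (k : ℕ) (x : (K.obj k).V) : Quotient (chainSetoid K) :=
  Quotient.mk (chainSetoid K) ⟨k, x⟩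

theorem chainMk_trans {k l : ℕ} (h : k ≤ l) (x : (K.obj k).V) :
    chainMk K l (trans K h x) = chainMk K k x :=
  Quotient.sound (s := chainSetoid K) ⟨l, le_rfl, h, trans_refl K _ _⟩

variable {K} in
theorem chainMk_eq {k l : ℕ} {x : (K.obj k).V} {y : (K.obj l).V}
    (h : chainMk K k x = chainMk K l y) :
    ∃ m, ∃ (h : k ≤ m) (h' : l ≤ m), trans K h x = trans K h' y :=
  Quotient.exact (s := chainSetoid K) h

/-- The edges of the colimit of a chain. -/
def ChainEdge (X : Quotient (chainSetoid K)) (l : Option A) (Y : Quotient (chainSetoid K)) : Prop :=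
  ∃ k x y, (K.obj k).Edge x l y ∧ chainMk K k x = X ∧ chainMk K k y = Y

/-- The colimit of a chain of trees. -/
def chainColimit : SyncTree A where
  V := Quotient (chainSetoid K)
  countable := by
    have := fun k => (K.obj k).countable
    exact inferInstanceAs (Countable (Quotient (chainSetoid K)))
  root := chainMk K 0 (K.obj 0).root
  Edge := ChainEdge K
  -- Each tree axiom involves at most two edges, and these can be moved to a common stage of the
  -- chain, where the axiom holds.
  uniquePath := unique_path_of_parent
    (by
      rintro _ l ⟨k, x, y, e, rfl, h⟩
      obtain ⟨m, h1, h2, h3⟩ := chainMk_eq h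
      rw [trans_root] at h3
      exact (K.obj m).root_in _ _ (h3 ▸ trans_edge h1 e))
    (by
      rintro _ l _ l' _ ⟨k, x, y, e, rfl, rfl⟩ ⟨k', x', y', e', rfl, h⟩
      obtain ⟨m, h1, h2, h3⟩ := chainMk_eq h
      have e1 := trans_edge h2 e
      obtain ⟨h4, rfl⟩ := (K.obj m).parent (h3 ▸ e1) (trans_edge h1 e')
      refine ⟨?_, rfl⟩
      rw [← chainMk_trans K h2, h4, chainMk_trans])
    (by
      intro X
      obtain ⟨⟨k, x⟩, rfl⟩ := Quotient.exists_rep X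
      change Relation.ReflTransGen _ _ (chainMk K k x)
      induction (K.obj k).reach x with
      | refl => rw [← trans_root K (Nat.zero_le k), chainMk_trans]
      | tail _ e ih =>
        obtain ⟨l, e⟩ := e
        exact ih.tail ⟨l, k, _, _, e, rfl, rfl⟩)
  exit_leaf := by
    rintro _ _ ⟨k, x, y, e, rfl, rfl⟩ l _ ⟨k', y', z', e', h, rfl⟩
    obtain ⟨m, h1, h2, h3⟩ := chainMk_eq h
    have e1 := trans_edge h2 e
    rw [← h3] at e1
    exact (K.obj m).exit_leaf e1 _ _ (trans_edge h1 e')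

/-- The colimit cocone of a chain of trees. -/
def chainCocone : Cocone K where
  pt := chainColimit K
  ι :=
    { app := fun k =>
        { toFun := chainMk K k
          map_root := by
            rw [← trans_root K (Nat.zero_le k), chainMk_trans]
            rfl
          map_edge := fun e => ⟨k, _, _, e, rfl, rfl⟩ }
      naturality := fun k l f => hom_ext (funext fun x => chainMk_trans K (leOfHom f) x) }

theorem cocone_trans {K : ℕ ⥤ SyncTree A} (s : Cocone K) {k l : ℕ} (h : k ≤ l) (x : (K.obj k).V) :
    Hom.toFun (s.ι.app l) (trans K h x) = Hom.toFun (s.ι.app k) x := by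
  rw [trans, ← s.w (homOfLE h), comp_toFun]

/-- `chainCocone` is a colimit. -/
def chainCoconeIsColimit : IsColimit (chainCocone K) where
  desc s :=
    { toFun := Quotient.lift (s := chainSetoid K) (fun p => Hom.toFun (s.ι.app p.1) p.2) (by
        rintro ⟨k, x⟩ ⟨l, y⟩ ⟨m, h, h', e⟩
        dsimp only at *
        rw [← cocone_trans s h, e, cocone_trans])
      map_root := Hom.map_root (s.ι.app 0)
      map_edge := by
        rintro _ l _ ⟨k, x, y, e, rfl, rfl⟩
        exact Hom.map_edge (s.ι.app k) e }
  fac s k := rfl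
  uniq s m hm := by
    apply hom_ext
    funext X
    obtain ⟨⟨k, x⟩, rfl⟩ := Quotient.exists_rep X
    exact congrFun (congrArg Hom.toFun (hm k)) x

theorem chainCocone_surjective (x : (chainColimit K).V) :
    ∃ k y, Hom.toFun ((chainCocone K).ι.app k) y = x := by
  obtain ⟨⟨k, y⟩, rfl⟩ := Quotient.exists_rep x
  exact ⟨k, y, rfl⟩

theorem chainCocone_injective {k : ℕ} {x y : (K.obj k).V}
    (h : Hom.toFun ((chainCocone K).ι.app k) x = Hom.toFun ((chainCocone K).ι.app k) y) :
    ∃ m, ∃ h : k ≤ m, trans K h x = trans K h y := by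
  obtain ⟨m, h, _, e⟩ := chainMk_eq h
  exact ⟨m, h, e⟩

end Colimit

/-- A bijective morphism is an isomorphism. -/
theorem exists_iso_of_bijective {t s : SyncTree A} (f : t ⟶ s)
    (hf : Function.Bijective (Hom.toFun f)) : ∃ e : t ≅ s, e.hom = f := by
  let g := (Equiv.ofBijective _ hf).symm
  have hg : ∀ x, Hom.toFun f (g x) = x := (Equiv.ofBijective _ hf).apply_symm_apply
  have hg' : ∀ x, g (Hom.toFun f x) = x := (Equiv.ofBijective _ hf).symm_apply_apply
  refine ⟨⟨f, ({ toFun := g, map_root := ?_, map_edge := ?_ } : Hom s t), ?_, ?_⟩, rfl⟩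
  · rw [← Hom.map_root f, hg']
  · intro x l y h
    -- In trees an edge into a vertex of the image lifts, so a bijective morphism reflects edges.
    rw [← hg y] at h
    obtain ⟨z, e, rfl⟩ := Hom.exists_edge_lift f h
    rwa [hg']
  · exact hom_ext (funext hg')
  · exact hom_ext (funext hg)

variable {A : Type u}

/-! ### Isomorphisms for sums and products -/

theorem sumMap_comp {t t' t'' s s' s'' : SyncTree A} (f : t ⟶ t') (f' : t' ⟶ t'') (g : s ⟶ s')
    (g' : s' ⟶ s'') : sumMap f g ≫ sumMap f' g' = sumMap (f ≫ f') (g ≫ g') := rfl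

theorem prodMap_comp {t t' t'' s s' s'' : SyncTree A} (f : t ⟶ t') (f' : t' ⟶ t'') (g : s ⟶ s')
    (g' : s' ⟶ s'') : prodMap f g ≫ prodMap f' g' = prodMap (f ≫ f') (g ≫ g') := rfl

/-- Sums of isomorphisms. -/
def sumIso {t t' s s' : SyncTree A} (e : t ≅ t') (e' : s ≅ s') : sum t s ≅ sum t' s' where
  hom := sumMap e.hom e'.hom
  inv := sumMap e.inv e'.inv
  hom_inv_id := by rw [sumMap_comp, e.hom_inv_id, e'.hom_inv_id]; rfl
  inv_hom_id := by rw [sumMap_comp, e.inv_hom_id, e'.inv_hom_id]; rfl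

/-- Products of isomorphisms. -/
def prodIso {t t' s s' : SyncTree A} (e : t ≅ t') (e' : s ≅ s') : prod t s ≅ prod t' s' where
  hom := prodMap e.hom e'.hom
  inv := prodMap e.inv e'.inv
  hom_inv_id := by rw [prodMap_comp, e.hom_inv_id, e'.hom_inv_id]; rfl
  inv_hom_id := by rw [prodMap_comp, e.inv_hom_id, e'.inv_hom_id]; rfl

/-- The inclusion of the first summand. -/
def inl (t s : SyncTree A) : t ⟶ sum t s where
  toFun x := ⟨(x, s.root), Or.inr rfl⟩
  map_root := rfl
  map_edge e := Or.inl ⟨e, rfl, rfl⟩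

/-- The inclusion of the second summand. -/
def inr (t s : SyncTree A) : s ⟶ sum t s where
  toFun y := ⟨(t.root, y), Or.inl rfl⟩
  map_root := rfl
  map_edge e := Or.inr ⟨e, rfl, rfl⟩

theorem sum_cases {t s : SyncTree A} (p : (sum t s).V) :
    (∃ x, p = Hom.toFun (inl t s) x) ∨ ∃ y, p = Hom.toFun (inr t s) y := by
  obtain ⟨⟨x, y⟩, h | h⟩ := p <;> dsimp only at h <;> subst h
  · exact Or.inr ⟨y, rfl⟩
  · exact Or.inl ⟨x, rfl⟩

open Classical in
/-- The morphism from a sum given by morphisms from the summands. -/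
noncomputable def sumDesc {t s r : SyncTree A} (f : t ⟶ r) (g : s ⟶ r) : sum t s ⟶ r where
  toFun p := if p.1.2 = s.root then Hom.toFun f p.1.1 else Hom.toFun g p.1.2
  map_root := by
    change (if s.root = s.root then Hom.toFun f t.root else _) = _
    rw [if_pos rfl]
    exact Hom.map_root f
  map_edge := by
    rintro p l q (⟨h, h1, h2⟩ | ⟨h, h1, h2⟩)
    · rw [if_pos h1, if_pos h2]
      exact Hom.map_edge f h
    · have hq : q.1.2 ≠ s.root := fun h' => s.root_in _ _ (h' ▸ h)
      rw [if_neg hq]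
      have h3 := Hom.map_edge g h
      split_ifs with h4
      · rw [h1, Hom.map_root f]
        rwa [h4, Hom.map_root g] at h3
      · exact h3

theorem inl_sumDesc {t s r : SyncTree A} (f : t ⟶ r) (g : s ⟶ r) : inl t s ≫ sumDesc f g = f :=
  hom_ext (funext fun _ => if_pos rfl)

theorem inr_sumDesc {t s r : SyncTree A} (f : t ⟶ r) (g : s ⟶ r) : inr t s ≫ sumDesc f g = g := by
  refine hom_ext (funext fun y => ?_)
  by_cases h : y = s.root
  · rw [h]
    exact (if_pos rfl).trans ((Hom.map_root f).trans (Hom.map_root g).symm)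
  · exact if_neg h

theorem sum_hom_ext {t s r : SyncTree A} {f g : sum t s ⟶ r} (h : inl t s ≫ f = inl t s ≫ g)
    (h' : inr t s ≫ f = inr t s ≫ g) : f = g := by
  refine hom_ext (funext fun p => ?_)
  obtain ⟨x, rfl⟩ | ⟨y, rfl⟩ := sum_cases p
  · exact congrFun (congrArg Hom.toFun h) x
  · exact congrFun (congrArg Hom.toFun h') y

theorem inl_sumMap {t t' s s' : SyncTree A} (f : t ⟶ t') (g : s ⟶ s') :
    inl t s ≫ sumMap f g = f ≫ inl t' s' :=
  hom_ext (funext fun _ => Subtype.ext (Prod.ext rfl (Hom.map_root g)))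

theorem inr_sumMap {t t' s s' : SyncTree A} (f : t ⟶ t') (g : s ⟶ s') :
    inr t s ≫ sumMap f g = g ≫ inr t' s' :=
  hom_ext (funext fun _ => Subtype.ext (Prod.ext (Hom.map_root f) rfl))

/-- The comparison morphism for right distributivity. -/
noncomputable def distrib (t s r : SyncTree A) : sum (prod t r) (prod s r) ⟶ prod (sum t s) r :=
  sumDesc (prodMap (inl t s) (𝟙 r)) (prodMap (inr t s) (𝟙 r))

theorem distrib_inl (t s r : SyncTree A) (x : (prod t r).V) :
    Hom.toFun (distrib t s r) (Hom.toFun (inl _ _) x) = Hom.toFun (prodMap (inl t s) (𝟙 r)) x :=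
  congrFun (congrArg Hom.toFun (inl_sumDesc _ _)) x

theorem distrib_inr (t s r : SyncTree A) (x : (prod s r).V) :
    Hom.toFun (distrib t s r) (Hom.toFun (inr _ _) x) = Hom.toFun (prodMap (inr t s) (𝟙 r)) x :=
  congrFun (congrArg Hom.toFun (inr_sumDesc _ _)) x

theorem distrib_natural {t t' s s' r r' : SyncTree A} (f : t ⟶ t') (g : s ⟶ s') (h : r ⟶ r') :
    sumMap (prodMap f h) (prodMap g h) ≫ distrib t' s' r' =
      distrib t s r ≫ prodMap (sumMap f g) h := by
  apply sum_hom_ext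
  · rw [← Category.assoc, inl_sumMap, Category.assoc, distrib, inl_sumDesc, distrib,
      ← Category.assoc, inl_sumDesc, prodMap_comp, prodMap_comp, inl_sumMap]
    rfl
  · rw [← Category.assoc, inr_sumMap, Category.assoc, distrib, inr_sumDesc, distrib,
      ← Category.assoc, inr_sumDesc, prodMap_comp, prodMap_comp, inr_sumMap]
    rfl

/-- The exit edges of `t + s` are those of `t` together with those of `s`, and the images of `t · r`
and `s · r` meet only in the root. -/
theorem distrib_bijective (t s r : SyncTree A) : Function.Bijective (Hom.toFun (distrib t s r)) := by
  have key : ∀ (x : (prod t r).V) (y : (prod s r).V),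
      Hom.toFun (prodMap (inl t s) (𝟙 r)) x = Hom.toFun (prodMap (inr t s) (𝟙 r)) y →
      x = (prod t r).root ∧ y = (prod s r).root := by
    rintro ⟨⟨x, x'⟩, hx⟩ ⟨⟨y, y'⟩, hy⟩ h
    have h1 := congrArg (fun p => p.1.1.1.1) h
    have h2 := congrArg (fun p => p.1.1.1.2) h
    have h3 := congrArg (fun p => p.1.2) h
    change x = t.root at h1
    change s.root = y at h2
    change x' = y' at h3
    subst h1 h2 h3
    have h4 : x' = r.root := by
      by_contra h
      exact t.not_isExitTarget_root (hx.2 h)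
    subst h4
    exact ⟨rfl, rfl⟩
  constructor
  · intro p q h
    obtain ⟨x, rfl⟩ | ⟨x, rfl⟩ := sum_cases p <;> obtain ⟨y, rfl⟩ | ⟨y, rfl⟩ := sum_cases q <;>
      simp only [distrib_inl, distrib_inr] at h
    · congr 1
      exact Subtype.ext (Prod.ext (congrArg (fun p => p.1.1.1.1) h) (congrArg (fun p => p.1.2) h))
    · obtain ⟨rfl, rfl⟩ := key _ _ h
      rfl
    · obtain ⟨rfl, rfl⟩ := key _ _ h.symm
      rfl
    · congr 1
      exact Subtype.ext (Prod.ext (congrArg (fun p => p.1.1.1.2) h) (congrArg (fun p => p.1.2) h))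
  · rintro ⟨⟨p, y⟩, hp⟩
    obtain ⟨x, rfl⟩ | ⟨x, rfl⟩ := sum_cases p
    · exact ⟨Hom.toFun (inl _ _) ⟨(x, y), (Hom.isExitTarget_iff (inl t s) x).symm.trans hp⟩,
        distrib_inl _ _ _ _⟩
    · exact ⟨Hom.toFun (inr _ _) ⟨(x, y), (Hom.isExitTarget_iff (inr t s) x).symm.trans hp⟩,
        distrib_inr _ _ _ _⟩

/-- All exit edges of `t` are replaced, so the exit edges of `t · s` are exactly those in the copies
of `s`. -/
theorem isExitTarget_prod_iff {t s : SyncTree A} (p : (prod t s).V) :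
    (prod t s).IsExitTarget p ↔ s.IsExitTarget p.1.2 := by
  constructor
  · rintro ⟨q, ⟨h, _, h2⟩ | ⟨h, _, h2⟩ | ⟨_, h⟩⟩
    · exact absurd h2 (p.2.1 ⟨_, h⟩)
    · exact ⟨_, h2⟩
    · exact ⟨_, h⟩
  · rintro ⟨w, hw⟩
    have hp : p.1.2 ≠ s.root := fun h => s.root_in _ _ (h ▸ hw)
    obtain ⟨z, hz⟩ := p.2.2 hp
    by_cases h : w = s.root
    · subst h
      exact ⟨⟨(z, s.root), iff_of_false (not_isExitTarget_of_edge hz) (fun h => h rfl)⟩,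
        Or.inr (Or.inl ⟨hz, rfl, hw⟩)⟩
    · exact ⟨⟨(p.1.1, w), iff_of_true ⟨z, hz⟩ h⟩, Or.inr (Or.inr ⟨rfl, hw⟩)⟩

/-- The comparison morphism for associativity. -/
def assoc (t s r : SyncTree A) : prod (prod t s) r ⟶ prod t (prod s r) where
  toFun p := ⟨(p.1.1.1.1, ⟨(p.1.1.1.2, p.1.2), (isExitTarget_prod_iff p.1.1).symm.trans p.2⟩), by
    obtain ⟨⟨⟨⟨x, y⟩, h⟩, z⟩, h'⟩ := p
    refine h.trans ⟨fun hy e => hy (congrArg (fun q => q.1.1) e), ?_⟩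
    rintro hz rfl
    refine hz (Subtype.ext (Prod.ext rfl ?_))
    by_contra hz'
    exact s.not_isExitTarget_root ((isExitTarget_prod_iff _).1 (h'.2 hz'))⟩
  map_root := rfl
  map_edge := by
    rintro ⟨⟨⟨⟨x, y⟩, h⟩, z⟩, hp⟩ l ⟨⟨⟨⟨x', y'⟩, h'⟩, z'⟩, hq⟩ e
    obtain ⟨e | e | e, e1, e2⟩ | ⟨e | e | e, e1, e2⟩ | ⟨e, e'⟩ := e <;> dsimp only at *
    · obtain ⟨e3, rfl, rfl⟩ := e
      subst e1 e2
      exact Or.inl ⟨e3, rfl, rfl⟩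
    · obtain ⟨e3, rfl, e5⟩ := e
      subst e1 e2
      exact Or.inr (Or.inl ⟨e3, rfl, Or.inl ⟨e5, rfl, rfl⟩⟩)
    · obtain ⟨rfl, e5⟩ := e
      subst e1 e2
      exact Or.inr (Or.inr ⟨rfl, Or.inl ⟨e5, rfl, rfl⟩⟩)
    · obtain ⟨e3, rfl, rfl⟩ := e
      exact absurd rfl (h'.1 ⟨_, e3⟩)
    · obtain ⟨e3, rfl, e5⟩ := e
      subst e1
      exact Or.inr (Or.inl ⟨e3, rfl, Or.inr (Or.inl ⟨e5, rfl, e2⟩)⟩)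
    · obtain ⟨rfl, e5⟩ := e
      subst e1
      exact Or.inr (Or.inr ⟨rfl, Or.inr (Or.inl ⟨e5, rfl, e2⟩)⟩)
    · obtain ⟨rfl, rfl⟩ := Prod.ext_iff.1 (congrArg Subtype.val e)
      exact Or.inr (Or.inr ⟨rfl, Or.inr (Or.inr ⟨rfl, e'⟩)⟩)

theorem assoc_natural {t t' s s' r r' : SyncTree A} (f : t ⟶ t') (g : s ⟶ s') (h : r ⟶ r') :
    prodMap (prodMap f g) h ≫ assoc t' s' r' = assoc t s r ≫ prodMap f (prodMap g h) := rfl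

theorem assoc_bijective (t s r : SyncTree A) : Function.Bijective (Hom.toFun (assoc t s r)) := by
  constructor
  · intro p q h
    refine Subtype.ext (Prod.ext (Subtype.ext (Prod.ext ?_ ?_)) ?_)
    · exact congrArg (fun p => p.1.1) h
    · exact congrArg (fun p => p.1.2.1.1) h
    · exact congrArg (fun p => p.1.2.1.2) h
  · rintro ⟨⟨x, ⟨⟨y, z⟩, h⟩⟩, h'⟩
    have hxy : t.IsExitTarget x ↔ y ≠ s.root := by
      constructor
      · rintro hx rfl
        refine h'.1 hx (Subtype.ext (Prod.ext rfl ?_))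
        by_contra hz
        exact s.not_isExitTarget_root (h.2 hz)
      · intro hy
        exact h'.2 fun e => hy (congrArg (fun q => q.1.1) e)
    exact ⟨⟨(⟨(x, y), hxy⟩, z), (isExitTarget_prod_iff _).trans h⟩, rfl⟩

/-- The projection `1 · s ⟶ s`. -/
def oneProd (s : SyncTree A) : prod (one A) s ⟶ s where
  toFun p := p.1.2
  map_root := rfl
  map_edge := by
    rintro p l q (⟨h, _, h2⟩ | ⟨_, h1, h⟩ | ⟨_, h⟩)
    · obtain ⟨h3, h4, h5⟩ := h
      exact absurd h2 (q.2.1 ⟨false, rfl, rfl, h5⟩)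
    · rwa [h1]
    · exact h

theorem isExitTarget_one_iff (x : (one A).V) : (one A).IsExitTarget x ↔ x = true :=
  ⟨fun ⟨_, _, _, h⟩ => h, fun h => ⟨false, rfl, rfl, h⟩⟩

/-- The first coordinate carries no information: it is `true` exactly when the second is not the
root. -/
theorem oneProd_bijective (s : SyncTree A) : Function.Bijective (Hom.toFun (oneProd s)) := by
  constructor
  · rintro ⟨⟨x, y⟩, h⟩ ⟨⟨x', y'⟩, h'⟩ e
    obtain rfl : y = y' := e
    have h1 := (h.trans h'.symm)
    rw [isExitTarget_one_iff, isExitTarget_one_iff] at h1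
    obtain rfl : x = x' := Bool.eq_iff_iff.2 h1
    rfl
  · intro y
    by_cases h : y = s.root
    · exact ⟨⟨(false, y), iff_of_false (one A).not_isExitTarget_root (fun h' => h' h)⟩, rfl⟩
    · exact ⟨⟨(true, y), iff_of_true ((isExitTarget_one_iff _).2 rfl) h⟩, rfl⟩

/-- The projection `t · 1 ⟶ t`. -/
def prodOne (t : SyncTree A) : prod t (one A) ⟶ t where
  toFun p := p.1.1
  map_root := rfl
  map_edge := by
    rintro p l q (⟨h, _, _⟩ | ⟨h, _, _, rfl, _⟩ | ⟨h1, h2, _, h3⟩)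
    · exact h
    · exact h
    · have h4 := q.2.2 (by rw [h3]; exact Bool.noConfusion)
      rw [← h1] at h4
      exact absurd h2 (p.2.1 h4)

theorem prodOne_bijective (t : SyncTree A) : Function.Bijective (Hom.toFun (prodOne t)) := by
  have key : ∀ p : (prod t (one A)).V, t.IsExitTarget p.1.1 ↔ p.1.2 = true := by
    intro p
    refine p.2.trans ?_
    exact iff_of_eq (Bool.not_eq_false _)
  constructor
  · intro p q h
    refine Subtype.ext (Prod.ext h (Bool.eq_iff_iff.2 ?_))
    exact (key p).symm.trans ((iff_of_eq (congrArg t.IsExitTarget h)).trans (key q))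
  · intro x
    by_cases h : t.IsExitTarget x
    · exact ⟨⟨(x, true), iff_of_true h Bool.noConfusion⟩, rfl⟩
    · exact ⟨⟨(x, false), iff_of_false h (fun h => h rfl)⟩, rfl⟩

/-- The morphism `0 ⟶ 0 · s`. -/
def zeroProd (s : SyncTree A) : zero A ⟶ prod (zero A) s := (zeroIsInitial A).to _

theorem zeroProd_bijective (s : SyncTree A) : Function.Bijective (Hom.toFun (zeroProd s)) := by
  refine ⟨fun _ _ _ => rfl, ?_⟩
  rintro ⟨⟨x, y⟩, h⟩
  obtain rfl : y = s.root := by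
    by_contra hy
    obtain ⟨_, h⟩ := h.2 hy
    exact h
  exact ⟨(), rfl⟩

/-- Right distributivity. -/
noncomputable def distribIso (t s r : SyncTree A) :
    sum (prod t r) (prod s r) ≅ prod (sum t s) r :=
  (exists_iso_of_bijective _ (distrib_bijective t s r)).choose

theorem distribIso_hom (t s r : SyncTree A) : (distribIso t s r).hom = distrib t s r :=
  (exists_iso_of_bijective _ (distrib_bijective t s r)).choose_spec

/-- Associativity. -/
noncomputable def assocIso (t s r : SyncTree A) : prod (prod t s) r ≅ prod t (prod s r) :=
  (exists_iso_of_bijective _ (assoc_bijective t s r)).choose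

theorem assocIso_hom (t s r : SyncTree A) : (assocIso t s r).hom = assoc t s r :=
  (exists_iso_of_bijective _ (assoc_bijective t s r)).choose_spec

/-- `1` is a left unit. -/
noncomputable def oneProdIso (s : SyncTree A) : prod (one A) s ≅ s :=
  (exists_iso_of_bijective _ (oneProd_bijective s)).choose

theorem oneProdIso_hom (s : SyncTree A) : (oneProdIso s).hom = oneProd s :=
  (exists_iso_of_bijective _ (oneProd_bijective s)).choose_spec

/-- `1` is a right unit. -/
noncomputable def prodOneIso (t : SyncTree A) : prod t (one A) ≅ t :=
  (exists_iso_of_bijective _ (prodOne_bijective t)).choose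

theorem prodOneIso_hom (t : SyncTree A) : (prodOneIso t).hom = prodOne t :=
  (exists_iso_of_bijective _ (prodOne_bijective t)).choose_spec

/-- `0` is a left zero. -/
noncomputable def zeroProdIso (s : SyncTree A) : zero A ≅ prod (zero A) s :=
  (exists_iso_of_bijective _ (zeroProd_bijective s)).choose

theorem assocIso_inv_natural {t t' s s' r r' : SyncTree A} (f : t ⟶ t') (g : s ⟶ s')
    (h : r ⟶ r') : prodMap f (prodMap g h) ≫ (assocIso t' s' r').inv =
      (assocIso t s r).inv ≫ prodMap (prodMap f g) h := by
  rw [Iso.comp_inv_eq, Category.assoc, assocIso_hom, assoc_natural, ← assocIso_hom,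
    Iso.inv_hom_id_assoc]

theorem oneProdIso_inv_natural {s s' : SyncTree A} (f : s ⟶ s') :
    f ≫ (oneProdIso s').inv = (oneProdIso s).inv ≫ prodMap (𝟙 _) f := by
  rw [Iso.comp_inv_eq, Category.assoc, oneProdIso_hom, Iso.eq_inv_comp, oneProdIso_hom]
  rfl

end SyncTree

/-! ### `Δ`-regular trees are `Γ`-algebraic -/

section Translation

variable {A : Type u} {n m : ℕ}

/-- The `Γ`-term `0`. -/
def gZero {rank : Fin n → ℕ} : Term (Gamma A) rank m :=
  .op (S := Gamma A) GammaOp.zero (fun i : Fin 0 => i.elim0)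

section NatTrans

variable {rank : Fin n → ℕ} {f g : ∀ i, (Fin (rank i) → SyncTree A) ⥤ SyncTree A}
  (α : ∀ i, f i ⟶ g i) (x : Fin m → SyncTree A)

theorem gPlus_natTrans_app (p q : Term (Gamma A) rank m) :
    ((gPlus p q).natTrans (gammaTrees A) α).app x =
      SyncTree.sumMap ((p.natTrans (gammaTrees A) α).app x) ((q.natTrans (gammaTrees A) α).app x) :=
  Term.natTrans_op_app _ _ _ _ _

theorem gAct_natTrans_app (a : A) (p : Term (Gamma A) rank m) :
    ((gAct a p).natTrans (gammaTrees A) α).app x =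
      SyncTree.prodMap (𝟙 (SyncTree.letter a)) ((p.natTrans (gammaTrees A) α).app x) :=
  Term.natTrans_op_app _ _ _ _ _

end NatTrans

/-- The ranks of the function variables of the translated scheme. -/
def trRank (n : ℕ) : Fin (n + 1) → ℕ := Fin.cases 0 fun _ => 1

/-- The translation of a closed `Δ`-term `t` to a `Γ`-term for `t · w`. -/
def Term.tr : Term (Delta A) (fun _ : Fin n => 0) 0 → Term (Gamma A) (trRank n) m →
    Term (Gamma A) (trRank n) m
  | .var i, _ => i.elim0
  | .op .plus ts, w => gPlus ((ts (0 : Fin 2)).tr w) ((ts (1 : Fin 2)).tr w)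
  | .op .times ts, w => (ts (0 : Fin 2)).tr ((ts (1 : Fin 2)).tr w)
  | .op .zero _, _ => gZero
  | .op .one _, w => w
  | .op (.letter a) _, w => gAct a w
  | .app i _, w => .app i.succ fun _ => w

/-- The translation of a regular `Δ`-scheme to a `Γ`-scheme. -/
def trScheme (rhs : Fin (n + 1) → Term (Delta A) (fun _ : Fin (n + 1) => 0) 0) :
    Scheme (Gamma A) where
  n := n + 1
  rank := trRank (n + 1)
  rhs := Fin.cases (motive := fun i => Term (Gamma A) (trRank (n + 1)) (trRank (n + 1) i))
    (.app (Fin.succ 0) fun _ => gOne) fun i => (rhs i).tr (m := 1) (.var (0 : Fin 1))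

open SyncTree

variable {f g : Fin n → SyncTree A}
  {f' g' : ∀ i, (Fin (trRank n i) → SyncTree A) ⥤ SyncTree A}

/-- If the functor `f' (i + 1)` is `v ↦ f i · v`, then the translation of `t` denotes `t · w`. -/
noncomputable def Term.trIso
    (θ : ∀ i (x : Fin 1 → SyncTree A), (f' (Fin.succ i)).obj x ≅ prod (f i) (x 0)) :
    ∀ (t : Term (Delta A) (fun _ : Fin n => 0) 0) (w : Term (Gamma A) (trRank n) m)
      (x : Fin m → SyncTree A), ((t.tr w).functor (gammaTrees A) f').obj x ≅
        prod (t.value (deltaTrees A) f) ((w.functor (gammaTrees A) f').obj x)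
  | .var i, _, _ => i.elim0
  | .op .plus ts, w, x =>
      sumIso ((ts (0 : Fin 2)).trIso θ w x) ((ts (1 : Fin 2)).trIso θ w x) ≪≫ distribIso _ _ _
  | .op .times ts, w, x =>
      (ts (0 : Fin 2)).trIso θ ((ts (1 : Fin 2)).tr w) x ≪≫
        prodIso (Iso.refl _) ((ts (1 : Fin 2)).trIso θ w x) ≪≫ (assocIso _ _ _).symm
  | .op .zero _, _, _ => zeroProdIso _
  | .op .one _, _, _ => (oneProdIso _).symm
  | .op (.letter _) _, _, _ => Iso.refl _
  | .app i _, w, x => θ i fun _ => (w.functor (gammaTrees A) f').obj x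

variable (θ : ∀ i (x : Fin 1 → SyncTree A), (f' (Fin.succ i)).obj x ≅ prod (f i) (x 0))

/-- Naturality in the parameters is needed for nested calls: the connecting morphism of `F_i(w)` is
a component of `α i` followed by the image under a functor of the connecting morphism of `w`. -/
theorem Term.trIso_natural
  (hθ : ∀ i (x y : Fin 1 → SyncTree A) (z : x ⟶ y),
    (f' (Fin.succ i)).map z ≫ (θ i y).hom = (θ i x).hom ≫ prodMap (𝟙 _) (z 0))
    (t : Term (Delta A) (fun _ : Fin n => 0) 0)
    (w : Term (Gamma A) (trRank n) m) {x y : Fin m → SyncTree A} (z : x ⟶ y) :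
    ((t.tr w).functor (gammaTrees A) f').map z ≫ (t.trIso θ w y).hom =
      (t.trIso θ w x).hom ≫ prodMap (𝟙 _) ((w.functor (gammaTrees A) f').map z) := by
  induction t generalizing w with
  | var i => exact i.elim0
  | op σ ts ih =>
    cases σ with
    | plus =>
      change sumMap _ _ ≫ sumMap _ _ ≫ (distribIso _ _ _).hom =
        (sumMap _ _ ≫ (distribIso _ _ _).hom) ≫ prodMap (sumMap (𝟙 _) (𝟙 _)) _
      rw [distribIso_hom, distribIso_hom, Category.assoc, ← distrib_natural, ← Category.assoc,
        ← Category.assoc]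
      congr 1
      exact congrArg₂ sumMap (ih (0 : Fin 2) w) (ih (1 : Fin 2) w)
    | times =>
      change _ ≫ _ ≫ prodMap _ _ ≫ (assocIso _ _ _).inv =
        (_ ≫ prodMap _ _ ≫ (assocIso _ _ _).inv) ≫ prodMap (prodMap (𝟙 _) (𝟙 _)) _
      rw [Category.assoc, Category.assoc, ← assocIso_inv_natural, ← Category.assoc]
      refine (congrArg (· ≫ _) (ih (0 : Fin 2) ((ts (1 : Fin 2)).tr w))).trans ?_
      rw [Category.assoc]
      refine congrArg (_ ≫ ·) ?_
      rw [← Category.assoc, ← Category.assoc]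
      refine congrArg (· ≫ _) ?_
      exact congrArg (prodMap (𝟙 _)) (ih (1 : Fin 2) w)
    | zero => exact (zeroIsInitial A).hom_ext _ _
    | one => exact oneProdIso_inv_natural _
    | letter a => rfl
  | app i ts => exact hθ i _ _ _

/-- This is the induction step for comparing the two chains: if the identifications of `F_i(v)` with
`F_i · v` respect the connecting morphisms, so do those for every translated term. -/
theorem Term.natTrans_trIso
    {θ' : ∀ i (x : Fin 1 → SyncTree A), (g' (Fin.succ i)).obj x ≅ prod (g i) (x 0)}
    (hθ' : ∀ i (x y : Fin 1 → SyncTree A) (z : x ⟶ y),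
      (g' (Fin.succ i)).map z ≫ (θ' i y).hom = (θ' i x).hom ≫ prodMap (𝟙 _) (z 0))
    {α : ∀ i, f' i ⟶ g' i} {β : ∀ i, f i ⟶ g i}
    (h : ∀ i (x : Fin 1 → SyncTree A), (α (Fin.succ i)).app x ≫ (θ' i x).hom =
      (θ i x).hom ≫ prodMap (β i) (𝟙 _))
    (t : Term (Delta A) (fun _ : Fin n => 0) 0) (w : Term (Gamma A) (trRank n) m)
    (x : Fin m → SyncTree A) :
    ((t.tr w).natTrans (gammaTrees A) α).app x ≫ (t.trIso θ' w x).hom =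
      (t.trIso θ w x).hom ≫
        prodMap (t.valueMap (deltaTrees A) β) ((w.natTrans (gammaTrees A) α).app x) := by
  induction t generalizing w with
  | var i => exact i.elim0
  | op σ ts ih =>
    cases σ with
    | plus =>
      refine (congrArg (· ≫ _) (gPlus_natTrans_app _ _ _ _)).trans ?_
      change sumMap _ _ ≫ sumMap _ _ ≫ (distribIso _ _ _).hom =
        (sumMap _ _ ≫ (distribIso _ _ _).hom) ≫ prodMap (sumMap _ _) _
      rw [distribIso_hom, distribIso_hom, Category.assoc, ← distrib_natural, ← Category.assoc,
        ← Category.assoc]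
      congr 1
      exact congrArg₂ sumMap (ih (0 : Fin 2) w) (ih (1 : Fin 2) w)
    | times =>
      change _ ≫ _ ≫ prodMap _ _ ≫ (assocIso _ _ _).inv =
        (_ ≫ prodMap _ _ ≫ (assocIso _ _ _).inv) ≫ prodMap (prodMap _ _) _
      rw [Category.assoc, Category.assoc, ← assocIso_inv_natural, ← Category.assoc]
      refine (congrArg (· ≫ _) (ih (0 : Fin 2) ((ts (1 : Fin 2)).tr w))).trans ?_
      rw [Category.assoc]
      refine congrArg (_ ≫ ·) ?_
      rw [← Category.assoc, ← Category.assoc]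
      refine congrArg (· ≫ _) ?_
      exact congrArg (prodMap _) (ih (1 : Fin 2) w)
    | zero => exact (zeroIsInitial A).hom_ext _ _
    | one => exact oneProdIso_inv_natural _
    | letter a =>
      exact (congrArg (· ≫ 𝟙 _) (gAct_natTrans_app _ _ _ _)).trans rfl
  | app i ts =>
    refine (Category.assoc _ _ _).trans ?_
    refine (congrArg (_ ≫ ·) (hθ' i _ _ _)).trans ?_
    refine (Category.assoc _ _ _).symm.trans ?_
    exact (congrArg (· ≫ _) (h i _)).trans rfl

end Translation

section TranslatedScheme

open SyncTree

variable {A : Type u} {n : ℕ} (rhs : Fin (n + 1) → Term (Delta A) (fun _ : Fin (n + 1) => 0) 0)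

/-- The approximations of the translated scheme. -/
noncomputable def trApproxIso : ∀ k i (x : Fin 1 → SyncTree A),
    ((trScheme rhs).approx (gammaTrees A) k (Fin.succ i)).obj x ≅
      prod (regApprox (deltaTrees A) rhs k i) (x 0)
  | 0 => fun _ _ => zeroProdIso _
  | k + 1 => fun i x => (rhs i).trIso (trApproxIso k) (m := 1) (.var (0 : Fin 1)) x

theorem trApproxIso_natural (k : ℕ) (i : Fin (n + 1)) (x y : Fin 1 → SyncTree A) (z : x ⟶ y) :
    ((trScheme rhs).approx (gammaTrees A) k (Fin.succ i)).map z ≫ (trApproxIso rhs k i y).hom =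
      (trApproxIso rhs k i x).hom ≫ prodMap (𝟙 _) (z 0) := by
  induction k generalizing i x y with
  | zero => exact (zeroIsInitial A).hom_ext _ _
  | succ k ih => exact (rhs i).trIso_natural (trApproxIso rhs k) ih (m := 1) (.var (0 : Fin 1)) z

theorem approxMap_trApproxIso (k : ℕ) (i : Fin (n + 1)) (x : Fin 1 → SyncTree A) :
    ((trScheme rhs).approxMap (gammaTrees A) k (Fin.succ i)).app x ≫
        (trApproxIso rhs (k + 1) i x).hom =
      (trApproxIso rhs k i x).hom ≫ prodMap (regApproxMap (deltaTrees A) rhs k i) (𝟙 _) := by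
  induction k generalizing i x with
  | zero => exact (zeroIsInitial A).hom_ext _ _
  | succ k ih =>
    exact Term.natTrans_trIso (trApproxIso rhs k) (trApproxIso_natural rhs (k + 1)) ih (rhs i) (m := 1) (.var (0 : Fin 1)) x

/-- The start equation is a call of the first translated variable with the constant argument `1`, so
its approximations lag one step behind and the argument contributes only an identity. -/
theorem approxMap_succ_zero (k : ℕ) (x : Fin 0 → SyncTree A) :
    ((trScheme rhs).approxMap (gammaTrees A) (k + 1) 0).app x =
      ((trScheme rhs).approxMap (gammaTrees A) k (Fin.succ (0 : Fin (n + 1)))).app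
        (fun _ : Fin 1 => one A) :=
  (Term.natTrans_app_app _ _ _ _ _).trans
    ((congrArg (_ ≫ ·)
      (((trScheme rhs).approx (gammaTrees A) (k + 1) (Fin.succ (0 : Fin (n + 1)))).map_id
        (fun _ : Fin 1 => one A))).trans (Category.comp_id _))

theorem approxMap_zero_prodOne (k : ℕ) (x : Fin 0 → SyncTree A) :
    ((trScheme rhs).approxMap (gammaTrees A) (k + 1) 0).app x ≫
        (trApproxIso rhs (k + 1) (0 : Fin (n + 1)) (fun _ => one A) ≪≫ prodOneIso _).hom =
      (trApproxIso rhs k (0 : Fin (n + 1)) (fun _ => one A) ≪≫ prodOneIso _).hom ≫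
        regApproxMap (deltaTrees A) rhs k 0 := by
  refine (congrArg (· ≫ _) (approxMap_succ_zero rhs k x)).trans ?_
  refine (Category.assoc _ _ _).symm.trans ?_
  refine (congrArg (· ≫ _) (approxMap_trApproxIso rhs k (0 : Fin (n + 1)) _)).trans ?_
  rw [Iso.trans_hom, prodOneIso_hom, prodOneIso_hom]
  rfl

/-- `Δ`-regular trees are `Γ`-algebraic. -/
theorem DeltaRegular.gammaAlgebraic {t : SyncTree A} (ht : DeltaRegular t) : GammaAlgebraic t := by
  obtain ⟨n, rhs, s, ⟨hs⟩, ⟨e⟩⟩ := IsRegular.exists_regChain _ ht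
  have h0 : (trScheme rhs).rank 0 = 0 := rfl
  -- Stage `k + 1` of the start variable is stage `k` of the original component multiplied by `1` on
  -- the right, hence the shift.
  obtain ⟨s', hs', hpt⟩ := exists_isColimit_of_shift (K := regChain (deltaTrees A) rhs 0)
    (K' := (trScheme rhs).objDiagram (gammaTrees A) h0)
    (fun k => trApproxIso rhs k (0 : Fin (n + 1)) (fun _ => one A) ≪≫ prodOneIso _) (by
      intro k
      rw [Functor.ofSequence_map_homOfLE_succ, objDiagram_map_succ]
      exact approxMap_zero_prodOne rhs k _) hs
  exact ⟨trScheme rhs, h0, s', hs', ⟨e ≪≫ eqToIso hpt.symm⟩⟩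

end TranslatedScheme

/-! ### The states of the tree of words `aⁱbʲ` with `j ≤ i + 1` -/

/-- `up m`: after `aᵐ`. `down m`: `b` can be read at most `m` times. `done`: after an exit edge. -/
inductive AbState
  | up (m : ℕ) | down (m : ℕ) | done

/-- The transitions between states. -/
inductive AbStep {A : Type u} (a b : A) : AbState → Option A → AbState → Prop
  | climb (m : ℕ) : AbStep a b (.up m) (some a) (.up (m + 1))
  | turn (m : ℕ) : AbStep a b (.up m) (some b) (.down m)
  | fall (m : ℕ) : AbStep a b (.down (m + 1)) (some b) (.down m)
  | upExit (m : ℕ) : AbStep a b (.up m) none .done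
  | downExit (m : ℕ) : AbStep a b (.down m) none .done

namespace SyncTree

variable {A : Type u} {a b : A}

/-- Determinism of the transitions; the two moves from `up m` are told apart by `a ≠ b`. -/
theorem AbStep.unique (hab : a ≠ b) {q q' q'' : AbState} {l : Option A} (h : AbStep a b q l q')
    (h' : AbStep a b q l q'') : q' = q'' := by
  cases h <;> cases h' <;> first | rfl | exact absurd rfl hab

theorem AbStep.exit {q q' : AbState} (h : AbStep a b q none q') : q' = .done := by
  cases h <;> rfl

/-- `R` is a bisimulation between a tree and the states. -/
def IsStateRel (a b : A) (t : SyncTree A) (R : t.V → AbState → Prop) : Prop :=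
  ∀ x q, R x q → (∀ l y, t.Edge x l y → ∃ q', AbStep a b q l q' ∧ R y q') ∧
    ∀ l q', AbStep a b q l q' → ∃ y, t.Edge x l y ∧ R y q'

/-- The vertex `x` is bisimilar to the state `q`. -/
def HasState (a b : A) (t : SyncTree A) (x : t.V) (q : AbState) : Prop :=
  ∃ R, IsStateRel a b t R ∧ R x q

/-- The vertex `x` is bisimilar to the state `q` for `n` steps. -/
def HasStateUpTo (a b : A) (t : SyncTree A) : ℕ → t.V → AbState → Prop
  | 0, _, _ => True
  | n + 1, x, q => (∀ l y, t.Edge x l y → ∃ q', AbStep a b q l q' ∧ HasStateUpTo a b t n y q') ∧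
      ∀ l q', AbStep a b q l q' → ∃ y, t.Edge x l y ∧ HasStateUpTo a b t n y q'

/-- `R` has the transfer property in both directions. -/
def IsBisim (t s : SyncTree A) (R : t.V → s.V → Prop) : Prop :=
  (∀ x y, R x y → ∀ l x', t.Edge x l x' → ∃ y', s.Edge y l y' ∧ R x' y') ∧
    ∀ x y, R x y → ∀ l y', s.Edge y l y' → ∃ x', t.Edge x l x' ∧ R x' y'

variable {t s : SyncTree A}

theorem IsBisim.symm {R : t.V → s.V → Prop} (h : IsBisim t s R) :
    IsBisim s t fun y x => R x y :=
  ⟨fun y x => h.2 x y, fun y x => h.1 x y⟩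

theorem HasState.edge {x : t.V} {q : AbState} (h : HasState a b t x q) {l y}
    (e : t.Edge x l y) : ∃ q', AbStep a b q l q' ∧ HasState a b t y q' := by
  obtain ⟨R, hR, hx⟩ := h
  obtain ⟨q', h1, h2⟩ := (hR x q hx).1 l y e
  exact ⟨q', h1, R, hR, h2⟩

theorem HasState.step {x : t.V} {q : AbState} (h : HasState a b t x q) {l q'}
    (e : AbStep a b q l q') : ∃ y, t.Edge x l y ∧ HasState a b t y q' := by
  obtain ⟨R, hR, hx⟩ := h
  obtain ⟨y, h1, h2⟩ := (hR x q hx).2 l q' e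
  exact ⟨y, h1, R, hR, h2⟩

theorem HasState.edge_step (hab : a ≠ b) {x : t.V} {q : AbState} (h : HasState a b t x q) {l y}
    (e : t.Edge x l y) {q'} (e' : AbStep a b q l q') : HasState a b t y q' := by
  obtain ⟨q'', h1, h2⟩ := h.edge e
  rwa [AbStep.unique hab e' h1]

/-- Coinduction: adding the pair `(x, q)` to the union of all state bisimulations gives a state
bisimulation again. -/
theorem HasState.intro {x : t.V} {q : AbState}
    (h : ∀ l y, t.Edge x l y → ∃ q', AbStep a b q l q' ∧ HasState a b t y q')
    (h' : ∀ l q', AbStep a b q l q' → ∃ y, t.Edge x l y ∧ HasState a b t y q') :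
    HasState a b t x q := by
  refine ⟨fun y r => HasState a b t y r ∨ (y = x ∧ r = q), ?_, Or.inr ⟨rfl, rfl⟩⟩
  rintro y r (hy | ⟨rfl, rfl⟩)
  · refine ⟨fun l z e => ?_, fun l r' e => ?_⟩
    · obtain ⟨q', h1, h2⟩ := hy.edge e
      exact ⟨q', h1, Or.inl h2⟩
    · obtain ⟨z, h1, h2⟩ := hy.step e
      exact ⟨z, h1, Or.inl h2⟩
  · refine ⟨fun l z e => ?_, fun l r' e => ?_⟩
    · obtain ⟨q', h1, h2⟩ := h l z e
      exact ⟨q', h1, Or.inl h2⟩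
    · obtain ⟨z, h1, h2⟩ := h' l r' e
      exact ⟨z, h1, Or.inl h2⟩

theorem hasState_done {x : t.V} (h : ∀ l y, ¬ t.Edge x l y) : HasState a b t x .done :=
  HasState.intro (fun l y e => absurd e (h l y)) (fun l q' e => by cases e)

theorem HasState.upTo {x : t.V} {q : AbState} (h : HasState a b t x q) (n : ℕ) :
    HasStateUpTo a b t n x q := by
  induction n generalizing x q with
  | zero => trivial
  | succ n ih =>
    refine ⟨fun l y e => ?_, fun l q' e => ?_⟩
    · obtain ⟨q', h1, h2⟩ := h.edge e
      exact ⟨q', h1, ih h2⟩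
    · obtain ⟨y, h1, h2⟩ := h.step e
      exact ⟨y, h1, ih h2⟩

theorem HasStateUpTo.mono {n m : ℕ} (hnm : n ≤ m) {x : t.V} {q : AbState}
    (h : HasStateUpTo a b t m x q) : HasStateUpTo a b t n x q := by
  induction n generalizing m x q with
  | zero => trivial
  | succ n ih =>
    obtain ⟨m, rfl⟩ : ∃ k, m = k + 1 := ⟨m - 1, by omega⟩
    refine ⟨fun l y e => ?_, fun l q' e => ?_⟩
    · obtain ⟨q', h1, h2⟩ := h.1 l y e
      exact ⟨q', h1, ih (by omega) h2⟩
    · obtain ⟨y, h1, h2⟩ := h.2 l q' e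
      exact ⟨y, h1, ih (by omega) h2⟩

/-- State bisimulations compose with bisimulations of trees. The relation `R` need not relate the
roots, so this also carries states between a tree and its parts. -/
theorem HasState.of_isBisim {R : t.V → s.V → Prop} (hR : IsBisim t s R) {x y} (hxy : R x y)
    {q : AbState} (h : HasState a b t x q) : HasState a b s y q := by
  refine ⟨fun y q => ∃ x, R x y ∧ HasState a b t x q, ?_, x, hxy, h⟩
  rintro y q ⟨x, hxy, h⟩
  refine ⟨fun l y' e => ?_, fun l q' e => ?_⟩
  · obtain ⟨x', e', h'⟩ := hR.2 x y hxy l y' e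
    obtain ⟨q', h1, h2⟩ := h.edge e'
    exact ⟨q', h1, x', h', h2⟩
  · obtain ⟨x', e', h'⟩ := h.step e
    obtain ⟨y', h1, h2⟩ := hR.1 x y hxy l x' e'
    exact ⟨y', h1, x', h2, h'⟩

theorem HasStateUpTo.of_isBisim {R : t.V → s.V → Prop} (hR : IsBisim t s R) {n : ℕ} {x y}
    (hxy : R x y) {q : AbState} (h : HasStateUpTo a b t n x q) : HasStateUpTo a b s n y q := by
  induction n generalizing x y q with
  | zero => trivial
  | succ n ih =>
    refine ⟨fun l y' e => ?_, fun l q' e => ?_⟩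
    · obtain ⟨x', e', h'⟩ := hR.2 x y hxy l y' e
      obtain ⟨q', h1, h2⟩ := h.1 l x' e'
      exact ⟨q', h1, ih h' h2⟩
    · obtain ⟨x', e', h'⟩ := h.2 l q' e
      obtain ⟨y', h1, h2⟩ := hR.1 x y hxy l x' e'
      exact ⟨y', h1, ih h2 h'⟩

/-! ### Bisimulations between trees and their parts -/

theorem isBisim_iso (e : t ≅ s) : IsBisim t s fun x y => Hom.toFun e.hom x = y := by
  refine ⟨?_, ?_⟩
  · rintro x _ rfl l x' h
    exact ⟨_, Hom.map_edge e.hom h, rfl⟩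
  · rintro x _ rfl l y' h
    have h1 := Hom.map_edge e.inv h
    have h2 : Hom.toFun e.inv (Hom.toFun e.hom x) = x :=
      congrFun (congrArg Hom.toFun e.hom_inv_id) x
    have h3 : Hom.toFun e.hom (Hom.toFun e.inv y') = y' :=
      congrFun (congrArg Hom.toFun e.inv_hom_id) y'
    rw [h2] at h1
    exact ⟨_, h1, h3⟩

theorem Bisimilar.of_iso (e : t ≅ s) : t.Bisimilar s :=
  ⟨_, Hom.map_root e.hom, (isBisim_iso e).1, (isBisim_iso e).2⟩

theorem ne_root_of_edge {x l y} (h : t.Edge x l y) : y ≠ t.root := fun h' =>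
  t.root_in _ _ (h' ▸ h)

/-- The root is excluded because the root of the sum also carries the edges of the other summand. -/
theorem isBisim_inl (t s : SyncTree A) :
    IsBisim t (sum t s) fun x p => x ≠ t.root ∧ p = Hom.toFun (inl t s) x := by
  refine ⟨?_, ?_⟩
  · rintro x _ ⟨_, rfl⟩ l x' h
    exact ⟨_, Hom.map_edge (inl t s) h, ne_root_of_edge h, rfl⟩
  · rintro x _ ⟨hx, rfl⟩ l y' (⟨h, h1, h2⟩ | ⟨h, h1, h2⟩)
    · exact ⟨y'.1.1, h, ne_root_of_edge h, Subtype.ext (Prod.ext rfl h2)⟩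
    · exact absurd h1 hx

theorem isBisim_inr (t s : SyncTree A) :
    IsBisim s (sum t s) fun x p => x ≠ s.root ∧ p = Hom.toFun (inr t s) x := by
  refine ⟨?_, ?_⟩
  · rintro x _ ⟨_, rfl⟩ l x' h
    exact ⟨_, Hom.map_edge (inr t s) h, ne_root_of_edge h, rfl⟩
  · rintro x _ ⟨hx, rfl⟩ l y' (⟨h, h1, h2⟩ | ⟨h, h1, h2⟩)
    · exact absurd h1 hx
    · exact ⟨y'.1.2, h, ne_root_of_edge h, Subtype.ext (Prod.ext h2 rfl)⟩

/-- Inside a copy of `s`, below its root, the product looks like `s`. The root of a copy is a vertex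
of `t` and may have further edges. -/
theorem isBisim_prod_right (t s : SyncTree A) :
    IsBisim s (prod t s) fun y p => y ≠ s.root ∧ p.1.2 = y := by
  refine ⟨?_, ?_⟩
  · rintro _ p ⟨hp, rfl⟩ l y h
    exact ⟨⟨(p.1.1, y), iff_of_true (p.2.2 hp) (ne_root_of_edge h)⟩, Or.inr (Or.inr ⟨rfl, h⟩),
      ne_root_of_edge h, rfl⟩
  · rintro _ p ⟨hp, rfl⟩ l y (⟨_, h, _⟩ | ⟨_, h, _⟩ | ⟨_, h⟩)
    · exact absurd h hp
    · exact absurd h hp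
    · exact ⟨_, h, ne_root_of_edge h, rfl⟩

/-- The vertex of `t · s` given by a vertex of `t` that is not the target of an exit edge. -/
def prodLeft (t s : SyncTree A) (x : t.V) (hx : ¬ t.IsExitTarget x) : (prod t s).V :=
  ⟨(x, s.root), iff_of_false hx fun h => h rfl⟩

theorem prodLeft_edge {x : t.V} {hx : ¬ t.IsExitTarget x} {l p}
    (h : (prod t s).Edge (prodLeft t s x hx) l p) :
    (∃ y hy, t.Edge x l y ∧ p = prodLeft t s y hy) ∨
      (t.Edge x none p.1.1 ∧ s.Edge s.root l p.1.2) := by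
  obtain ⟨h, _, h2⟩ | ⟨h, _, h2⟩ | ⟨h, h2⟩ := h
  · exact Or.inl ⟨p.1.1, fun h' => p.2.1 h' h2, h, Subtype.ext (Prod.ext rfl h2)⟩
  · exact Or.inr ⟨h, h2⟩
  · have h3 := p.2.2 (ne_root_of_edge h2)
    rw [← show x = p.1.1 from h] at h3
    exact absurd h3 hx

theorem edge_prodLeft {x : t.V} (hx : ¬ t.IsExitTarget x) {l y} (hy : ¬ t.IsExitTarget y)
    (h : t.Edge x l y) : (prod t s).Edge (prodLeft t s x hx) l (prodLeft t s y hy) :=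
  Or.inl ⟨h, rfl, rfl⟩

theorem exists_edge_prodLeft {x : t.V} (hx : ¬ t.IsExitTarget x) {y} (h : t.Edge x none y) {l z}
    (hz : s.Edge s.root l z) : ∃ p : (prod t s).V,
      (prod t s).Edge (prodLeft t s x hx) l p ∧ p.1.1 = y ∧ p.1.2 = z :=
  ⟨⟨(y, z), iff_of_true ⟨x, h⟩ (ne_root_of_edge hz)⟩, Or.inr (Or.inl ⟨h, rfl, hz⟩), rfl, rfl⟩

/-! ### Uniqueness of states -/

/-- The number `m` is determined by how many letters `b` can be read in succession. -/
theorem HasState.down_unique {x : t.V} {m m' : ℕ}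
    (h : HasState a b t x (.down m)) (h' : HasState a b t x (.down m')) : m = m' := by
  induction m generalizing x m' with
  | zero =>
    cases m' with
    | zero => rfl
    | succ m' =>
      obtain ⟨y, e, -⟩ := h'.step (.fall m')
      obtain ⟨q, h1, -⟩ := h.edge e
      cases h1
  | succ m ih =>
    obtain ⟨y, e, h2⟩ := h.step (.fall m)
    obtain ⟨q, h1, h3⟩ := h'.edge e
    cases h1
    rw [ih h2 h3]

theorem HasState.up_unique (hab : a ≠ b) {x : t.V} {m m' : ℕ}
    (h : HasState a b t x (.up m)) (h' : HasState a b t x (.up m')) : m = m' := by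
  obtain ⟨y, e, h2⟩ := h.step (.turn m)
  exact h2.down_unique (h'.edge_step hab e (.turn m'))

/-! ### Products with the state `up m` are trivial -/

/-- If all edges from the root of `s` are exit edges, then states in `t · s` are states in `t`. -/
theorem HasState.of_prodLeft {y₀} (h0 : s.Edge s.root none y₀)
    (hs : ∀ l y, s.Edge s.root l y → l = none) {x : t.V} {hx : ¬ t.IsExitTarget x} {q : AbState}
    (h : HasState a b (prod t s) (prodLeft t s x hx) q) : HasState a b t x q := by
  refine ⟨fun x q => (∃ hx, HasState a b (prod t s) (prodLeft t s x hx) q) ∨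
    ((∀ l y, ¬ t.Edge x l y) ∧ q = .done), ?_, Or.inl ⟨hx, h⟩⟩
  rintro x q (⟨hx, h⟩ | ⟨h, rfl⟩)
  · refine ⟨fun l y e => ?_, fun l q' e => ?_⟩
    · cases l with
      | none =>
        obtain ⟨p, e', -, -⟩ := exists_edge_prodLeft hx e h0
        obtain ⟨q', h1, -⟩ := h.edge e'
        exact ⟨q', h1, Or.inr ⟨t.exit_leaf e, AbStep.exit h1⟩⟩
      | some c =>
        have hy : ¬ t.IsExitTarget y := by
          rintro ⟨z, hz⟩
          cases (t.parent e hz).2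
        obtain ⟨q', h1, h2⟩ := h.edge (edge_prodLeft hx hy e)
        exact ⟨q', h1, Or.inl ⟨hy, h2⟩⟩
    · obtain ⟨p, e', h2⟩ := h.step e
      obtain ⟨y, hy, e1, rfl⟩ | ⟨e1, e2⟩ := prodLeft_edge e'
      · exact ⟨y, e1, Or.inl ⟨hy, h2⟩⟩
      · obtain rfl := hs _ _ e2
        exact ⟨_, e1, Or.inr ⟨t.exit_leaf e1, AbStep.exit e⟩⟩
  · exact ⟨fun l y e => absurd e (h l y), fun l q' e => by cases e⟩

/-- An exit edge at a vertex of `t` in `t · s` can only be a root edge of a copy of `s` attached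
there, so `t` has an exit edge at that vertex and `s` has one at its root. -/
theorem exit_of_prodLeft {x : t.V} {hx : ¬ t.IsExitTarget x} {q : AbState}
    (h : HasState a b (prod t s) (prodLeft t s x hx) q) (hq : AbStep a b q none .done) :
    (∃ y, t.Edge x none y) ∧ ∃ z, s.Edge s.root none z := by
  obtain ⟨p, e, -⟩ := h.step hq
  obtain ⟨y, hy, e1, rfl⟩ | ⟨e1, e2⟩ := prodLeft_edge e
  · exact absurd ⟨x, e1⟩ hy
  · exact ⟨⟨_, e1⟩, ⟨_, e2⟩⟩

/-- If `s` has only exit edges at its root, multiplying by `s` does not change states. Otherwise a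
letter edge at the root of `s` leads to a vertex `z` that reappears wherever `t` can exit. If `x`
had a letter edge in `t`, the vertex `z` would have to continue both `up m` and its successor state,
which is impossible. So `x` has only exit edges in `t`, and all edges seen at `x` in the product
come from the root of `s`. -/
theorem HasState.up_of_prodLeft (hab : a ≠ b) {x : t.V} {hx : ¬ t.IsExitTarget x} {m : ℕ}
    (h : HasState a b (prod t s) (prodLeft t s x hx) (.up m)) :
    HasState a b t x (.up m) ∨ HasState a b s s.root (.up m) := by
  obtain ⟨⟨e, he⟩, ⟨e', he'⟩⟩ := exit_of_prodLeft h (.upExit m)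
  by_cases hs : ∀ l y, s.Edge s.root l y → l = none
  · exact Or.inl (h.of_prodLeft he' hs)
  right
  push Not at hs
  obtain ⟨l, z, hz, hl⟩ := hs
  -- The subtree of `s` at `z` does not depend on where the copy is attached, so its state is an
  -- `l`-successor of every state occurring at an exiting vertex of `t`.
  have hzs : ∀ {y : t.V} {hy : ¬ t.IsExitTarget y} {r : AbState},
      HasState a b (prod t s) (prodLeft t s y hy) r → (∃ w, t.Edge y none w) →
      ∃ r', AbStep a b r l r' ∧ HasState a b s z r' := by
    rintro y hy r hr ⟨w, hw⟩
    obtain ⟨p, e1, -, e2⟩ := exists_edge_prodLeft hy hw hz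
    obtain ⟨r', h1, h2⟩ := hr.edge e1
    exact ⟨r', h1, h2.of_isBisim (isBisim_prod_right t s).symm ⟨ne_root_of_edge hz, e2⟩⟩
  have hx' : ∀ c y, ¬ t.Edge x (some c) y := by
    intro c y hy
    have hy' : ¬ t.IsExitTarget y := by
      rintro ⟨w, hw⟩
      cases (t.parent hy hw).2
    obtain ⟨r, h1, h2⟩ := h.edge (edge_prodLeft hx hy' hy)
    obtain ⟨r₁, k1, k2⟩ := hzs h ⟨e, he⟩
    have hr : AbStep a b r none .done := by
      cases h1
      · exact .upExit _
      · exact .downExit _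
    -- Every state other than `done` can exit, so the target of the letter edge also carries copies
    -- of `s`. The state of `z` must then be an `l`-successor both of `up m` and of `up (m + 1)` or
    -- `down m`; no such state exists.
    obtain ⟨r₂, k3, k4⟩ := hzs h2 (exit_of_prodLeft h2 hr).1
    cases h1 with
    | climb =>
      cases k1 with
      | climb =>
        cases k3 with
        | climb => exact absurd (k2.up_unique hab k4) (by omega)
        | turn => exact hab rfl
      | turn =>
        cases k3 with
        | climb => exact hab rfl
        | turn => exact absurd (k2.down_unique k4) (by omega)
      | upExit => exact hl rfl
    | turn =>
      cases k1 with
      | climb =>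
        cases k3 with
        | fall => exact hab rfl
      | turn =>
        cases k3 with
        | fall => exact absurd (k2.down_unique k4) (by omega)
      | upExit => exact hl rfl
  refine HasState.intro (fun l y e1 => ?_) (fun l q' e1 => ?_)
  · obtain ⟨p, e2, -, e3⟩ := exists_edge_prodLeft hx he e1
    obtain ⟨q', h1, h2⟩ := h.edge e2
    exact ⟨q', h1, h2.of_isBisim (isBisim_prod_right t s).symm ⟨ne_root_of_edge e1, e3⟩⟩
  · obtain ⟨p, e2, h2⟩ := h.step e1
    obtain ⟨y, hy, e3, rfl⟩ | ⟨e3, e4⟩ := prodLeft_edge e2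
    · cases l with
      | none => exact absurd ⟨x, e3⟩ hy
      | some c => exact absurd e3 (hx' c y)
    · exact ⟨_, e4, h2.of_isBisim (isBisim_prod_right t s).symm ⟨ne_root_of_edge e4, rfl⟩⟩

variable {A : Type u} {a b : A}

/-! ### Prefixing -/

theorem not_isExitTarget_letter (c : A) : ¬ (letter c).IsExitTarget (1 : Fin 3) := by
  rintro ⟨y, ⟨_, h, _⟩ | ⟨_, _, h⟩⟩
  · cases h
  · exact absurd h (by decide)

/-- The target of the first edge of `c · s`. -/
def prefixVertex (c : A) (s : SyncTree A) : (prod (letter c) s).V :=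
  prodLeft (letter c) s (1 : Fin 3) (not_isExitTarget_letter c)

theorem edge_prefixVertex (c : A) (s : SyncTree A) :
    (prod (letter c) s).Edge (prod (letter c) s).root (some c) (prefixVertex c s) :=
  Or.inl ⟨Or.inl ⟨rfl, rfl, rfl⟩, rfl, rfl⟩

theorem eq_of_edge_prefix {c : A} {s : SyncTree A} {l p}
    (h : (prod (letter c) s).Edge (prod (letter c) s).root l p) :
    l = some c ∧ p = prefixVertex c s := by
  obtain ⟨⟨_, h, h'⟩ | ⟨h, _⟩, _, h2⟩ | ⟨⟨_, h, _⟩ | ⟨h, _⟩, _⟩ | ⟨h, h2⟩ := h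
  · exact ⟨h, Subtype.ext (Prod.ext h' h2)⟩
  · exact absurd h (show ¬ (0 : Fin 3) = 1 by decide)
  · cases h
  · exact absurd h (show ¬ (0 : Fin 3) = 1 by decide)
  · have h3 := p.2.2 (ne_root_of_edge h2)
    rw [← show (letter c).root = p.1.1 from h] at h3
    exact absurd h3 (not_isExitTarget_root _)

/-- Unlike in a general product, the root may be included: the vertex after `c` has no edges other
than those of the copy of `s`. -/
theorem isBisim_prefix (c : A) (s : SyncTree A) :
    IsBisim s (prod (letter c) s) fun y p =>
      (y = s.root ∧ p = prefixVertex c s) ∨ (y ≠ s.root ∧ p.1.2 = y) := by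
  have h12 : (letter c).Edge (1 : Fin 3) none (2 : Fin 3) := Or.inr ⟨rfl, rfl, rfl⟩
  refine ⟨?_, ?_⟩
  · rintro y p (⟨rfl, rfl⟩ | h) l y' e
    · obtain ⟨q, e1, -, e2⟩ := exists_edge_prodLeft (not_isExitTarget_letter c) h12 e
      exact ⟨q, e1, Or.inr ⟨ne_root_of_edge e, e2⟩⟩
    · obtain ⟨q, e1, e2⟩ := (isBisim_prod_right (letter c) s).1 y p h l y' e
      exact ⟨q, e1, Or.inr e2⟩
  · rintro y p (⟨rfl, rfl⟩ | h) l q e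
    · obtain ⟨z, hz, e1, rfl⟩ | ⟨e1, e2⟩ := prodLeft_edge e
      · obtain ⟨h, _⟩ | ⟨_, _, h⟩ := e1
        · exact absurd h (by decide)
        · subst h
          exact absurd ⟨_, h12⟩ hz
      · exact ⟨_, e2, Or.inr ⟨ne_root_of_edge e2, rfl⟩⟩
    · obtain ⟨q, e1, e2⟩ := (isBisim_prod_right (letter c) s).2 y p h l q e
      exact ⟨q, e1, Or.inr e2⟩

/-! ### The states of the approximations -/

theorem hasState_one : HasState a b (one A) (one A).root (.down 0) := by
  refine HasState.intro ?_ ?_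
  · rintro l y ⟨_, rfl, rfl⟩
    exact ⟨.done, .downExit 0, hasState_done (by rintro l y ⟨h, _⟩; cases h)⟩
  · intro l q h
    cases h
    exact ⟨true, ⟨rfl, rfl, rfl⟩, hasState_done (by rintro l y ⟨h, _⟩; cases h)⟩

/-- This is the effect of one recursive call on the parameter of `F`: the counter grows by one. -/
theorem hasState_one_add_prefix {v : SyncTree A} {m : ℕ}
    (h : HasState a b v v.root (.down m)) :
    HasState a b (sum (one A) (prod (letter b) v)) (sum (one A) (prod (letter b) v)).root
      (.down (m + 1)) := by
  have hdone : ∀ y : (one A).V, (one A).Edge (one A).root none y →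
      HasState a b (sum (one A) (prod (letter b) v)) (Hom.toFun (inl _ _) y) .done := by
    intro y e
    exact (hasState_done ((one A).exit_leaf e)).of_isBisim (isBisim_inl _ _)
      ⟨ne_root_of_edge e, rfl⟩
  have hdown : HasState a b (sum (one A) (prod (letter b) v))
      (Hom.toFun (inr _ _) (prefixVertex b v)) (.down m) :=
    (h.of_isBisim (isBisim_prefix b v) (Or.inl ⟨rfl, rfl⟩)).of_isBisim (isBisim_inr _ _)
      ⟨ne_root_of_edge (edge_prefixVertex b v), rfl⟩
  refine HasState.intro ?_ ?_
  · rintro l p (⟨e, _, h2⟩ | ⟨e, _, h2⟩)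
    · have hp : p = Hom.toFun (inl _ _) p.1.1 := Subtype.ext (Prod.ext rfl h2)
      obtain rfl : l = none := e.2.1
      rw [hp]
      exact ⟨.done, .downExit _, hdone _ e⟩
    · obtain ⟨rfl, h1⟩ := eq_of_edge_prefix e
      obtain rfl : p = Hom.toFun (inr _ _) (prefixVertex b v) :=
        Subtype.ext (Prod.ext h2 h1)
      exact ⟨_, .fall _, hdown⟩
  · intro l q e
    cases e with
    | fall => exact ⟨_, Hom.map_edge (inr _ _) (edge_prefixVertex b v), hdown⟩
    | downExit =>
      have e : (one A).Edge (one A).root none true := ⟨rfl, rfl, rfl⟩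
      exact ⟨_, Hom.map_edge (inl _ _) e, hdone _ e⟩

/-- One unfolding of `F`. States `down (m + 1)` and `up m` have the same exit and the same
`b`-successor `down m`, so `v` supplies everything except the `a`-edge; this explains the shift by
one. -/
theorem hasStateUpTo_add_prefix {v r : SyncTree A} {m n : ℕ}
    (h : HasState a b v v.root (.down (m + 1))) (h' : HasStateUpTo a b r n r.root (.up (m + 1))) :
    HasStateUpTo a b (sum v (prod (letter a) r)) (n + 1) (sum v (prod (letter a) r)).root
      (.up m) := by
  have hv : ∀ {y : v.V} {l q}, v.Edge v.root l y → HasState a b v y q →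
      HasStateUpTo a b (sum v (prod (letter a) r)) n (Hom.toFun (inl _ _) y) q := by
    intro y l q e h
    exact (h.of_isBisim (isBisim_inl _ _) ⟨ne_root_of_edge e, rfl⟩).upTo n
  have hup : HasStateUpTo a b (sum v (prod (letter a) r)) n
      (Hom.toFun (inr _ _) (prefixVertex a r)) (.up (m + 1)) :=
    (h'.of_isBisim (isBisim_prefix a r) (Or.inl ⟨rfl, rfl⟩)).of_isBisim (isBisim_inr _ _)
      ⟨ne_root_of_edge (edge_prefixVertex a r), rfl⟩
  refine ⟨?_, ?_⟩
  · rintro l p (⟨e, _, h2⟩ | ⟨e, _, h2⟩)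
    · have hp : p = Hom.toFun (inl _ _) p.1.1 := Subtype.ext (Prod.ext rfl h2)
      obtain ⟨q, h3, h4⟩ := h.edge e
      rw [hp]
      refine ⟨q, ?_, hv e h4⟩
      cases h3
      · exact .turn m
      · exact .upExit m
    · obtain ⟨rfl, h1⟩ := eq_of_edge_prefix e
      obtain rfl : p = Hom.toFun (inr _ _) (prefixVertex a r) :=
        Subtype.ext (Prod.ext h2 h1)
      exact ⟨_, .climb _, hup⟩
  · intro l q e
    cases e with
    | climb => exact ⟨_, Hom.map_edge (inr _ _) (edge_prefixVertex a r), hup⟩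
    | turn =>
      obtain ⟨y, e, h3⟩ := h.step (.fall m)
      exact ⟨_, Hom.map_edge (inl _ _) e, hv e h3⟩
    | upExit =>
      obtain ⟨y, e, h3⟩ := h.step (.downExit (m + 1))
      exact ⟨_, Hom.map_edge (inl _ _) e, hv e h3⟩

/-- An approximation is cut off after finitely many unfoldings, so it agrees with the state only to
finite depth. -/
theorem hasStateUpTo_approx (a b : A) (k : ℕ) {m : ℕ} {v : SyncTree A}
    (h : HasState a b v v.root (.down (m + 1))) :
    HasStateUpTo a b (((abScheme a b).approx (gammaTrees A) k (1 : Fin 2)).obj fun _ : Fin 1 => v) k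
      (((abScheme a b).approx (gammaTrees A) k (1 : Fin 2)).obj fun _ : Fin 1 => v).root
      (.up m) := by
  induction k generalizing m v with
  | zero => trivial
  | succ k ih => exact hasStateUpTo_add_prefix h (ih (hasState_one_add_prefix h))

/-- A vertex of the colimit is related to `q` if, for each `n`, its images at all late stages behave
as `q` for `n` steps. Determinism makes the successor state independent of `n` and of the stage. -/
theorem hasState_chainColimit (hab : a ≠ b) (K : ℕ ⥤ SyncTree A) {q : AbState}
    (h : ∀ n, ∃ k, ∀ k', k ≤ k' → HasStateUpTo a b (K.obj k') n (K.obj k').root q) :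
    HasState a b (chainColimit K) (chainColimit K).root q := by
  refine ⟨fun X q => ∃ k x, chainMk K k x = X ∧ ∀ n, ∃ k₀, ∀ k', k₀ ≤ k' → ∀ h : k ≤ k',
    HasStateUpTo a b (K.obj k') n (trans K h x) q, ?_, ?_⟩
  swap
  · refine ⟨0, _, rfl, fun n => ?_⟩
    obtain ⟨k, hk⟩ := h n
    refine ⟨k, fun k' h1 h2 => ?_⟩
    rw [trans_root]
    exact hk k' h1
  rintro X q ⟨k, x, rfl, hx⟩
  have forward : ∀ l Y, (chainColimit K).Edge (chainMk K k x) l Y →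
      ∃ q', AbStep a b q l q' ∧ ∃ k x, chainMk K k x = Y ∧ ∀ n, ∃ k₀, ∀ k', k₀ ≤ k' →
        ∀ h : k ≤ k', HasStateUpTo a b (K.obj k') n (trans K h x) q' := by
    rintro l _ ⟨k₂, x₂, y₂, e, h1, rfl⟩
    obtain ⟨m, h2, h3, h4⟩ := chainMk_eq h1
    have e' := trans_edge h2 e
    rw [h4] at e'
    have e'' : ∀ {k'} (h : m ≤ k'), (K.obj k').Edge (trans K (h3.trans h) x) l
        (trans K h (trans K h2 y₂)) := by
      intro k' h
      rw [← trans_trans K h3 h]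
      exact trans_edge h e'
    obtain ⟨k₀, hk⟩ := hx 1
    obtain ⟨q', hq, -⟩ := (hk (max k₀ m) (le_max_left _ _) _).1 _ _ (e'' (le_max_right _ _))
    refine ⟨q', hq, m, trans K h2 y₂, chainMk_trans K h2 y₂, fun n => ?_⟩
    obtain ⟨k₁, hk₁⟩ := hx (n + 1)
    refine ⟨k₁, fun k' h5 h6 => ?_⟩
    obtain ⟨q'', hq', h7⟩ := (hk₁ k' h5 _).1 _ _ (e'' h6)
    rwa [AbStep.unique hab hq hq']
  refine ⟨forward, fun l q' hq => ?_⟩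
  obtain ⟨k₀, hk⟩ := hx 1
  obtain ⟨y, e, -⟩ := (hk (max k₀ k) (le_max_left _ _) (le_max_right _ _)).2 l q' hq
  have e' : (chainColimit K).Edge (chainMk K k x) l (chainMk K _ y) :=
    ⟨_, _, _, e, chainMk_trans K _ x, rfl⟩
  -- The edge was found at a single stage; by determinism, `forward` shows that its target has the
  -- required state at all depths.
  obtain ⟨q'', h1, h2⟩ := forward l _ e'
  rw [AbStep.unique hab hq h1]
  exact ⟨_, e', h2⟩

/-- The tree defined by `abScheme`. -/
theorem exists_abScheme_defines (hab : a ≠ b) : ∃ T : SyncTree A,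
    (abScheme a b).Defines (gammaTrees A) T ∧ HasState a b T T.root (.up 0) := by
  have h0 : (abScheme a b).rank 0 = 0 := rfl
  refine ⟨chainColimit ((abScheme a b).objDiagram (gammaTrees A) h0),
    ⟨h0, chainCocone _, ⟨chainCoconeIsColimit _⟩, ⟨Iso.refl _⟩⟩, ?_⟩
  -- Stage `k + 1` of `S` is stage `k` of `F` at `1 + b.1`, which has state `down 1`; hence depth
  -- `n` from stage `n + 1` on.
  refine hasState_chainColimit hab _ fun n => ⟨n + 1, fun k hk => ?_⟩
  obtain ⟨k, rfl⟩ : ∃ j, k = j + 1 := ⟨k - 1, by omega⟩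
  exact (hasStateUpTo_approx a b k (hasState_one_add_prefix hasState_one)).mono (by omega)

end SyncTree

/-- The subterms of a term that do not lie below a function variable. -/
def Term.subterms {S : Signature.{u}} {n : ℕ} {rank : Fin n → ℕ} {m : ℕ} :
    Term S rank m → Set (Term S rank m)
  | .var i => {.var i}
  | .op σ ts => insert (.op σ ts) (⋃ j, (ts j).subterms)
  | .app i ts => {.app i ts}

theorem Term.subterms_finite {S : Signature.{u}} {n : ℕ} {rank : Fin n → ℕ} {m : ℕ}
    (t : Term S rank m) : t.subterms.Finite := by
  induction t with
  | var i => exact Set.finite_singleton _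
  | op σ ts ih => exact (Set.finite_iUnion ih).insert _
  | app i ts => exact Set.finite_singleton _

theorem Term.mem_subterms {S : Signature.{u}} {n : ℕ} {rank : Fin n → ℕ} {m : ℕ}
    (t : Term S rank m) : t ∈ t.subterms := by
  cases t with
  | var i => exact Set.mem_singleton _
  | op σ ts => exact Set.mem_insert _ _
  | app i ts => exact Set.mem_singleton _

theorem Term.subterms_subset {S : Signature.{u}} {n : ℕ} {rank : Fin n → ℕ} {m : ℕ} (σ : S.Op)
    (ts : Fin (S.arity σ) → Term S rank m) (j : Fin (S.arity σ)) :
    (ts j).subterms ⊆ (Term.op σ ts).subterms :=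
  (Set.subset_iUnion (fun j => (ts j).subterms) j).trans (Set.subset_insert _ _)

/-! ### The initial solution of a regular Δ-scheme as a fixed point -/

open SyncTree

variable {A : Type u} {n : ℕ}

theorem SyncTree.sumMap_injective {t t' s s' : SyncTree A} {f : t ⟶ t'} {g : s ⟶ s'}
    (hf : Function.Injective (Hom.toFun f)) (hg : Function.Injective (Hom.toFun g)) :
    Function.Injective (Hom.toFun (sumMap f g)) := fun _ _ h =>
  Subtype.ext (Prod.ext (hf (congrArg (fun p => p.1.1) h)) (hg (congrArg (fun p => p.1.2) h)))

theorem SyncTree.prodMap_injective {t t' s s' : SyncTree A} {f : t ⟶ t'} {g : s ⟶ s'}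
    (hf : Function.Injective (Hom.toFun f)) (hg : Function.Injective (Hom.toFun g)) :
    Function.Injective (Hom.toFun (prodMap f g)) := fun _ _ h =>
  Subtype.ext (Prod.ext (hf (congrArg (fun p => p.1.1) h)) (hg (congrArg (fun p => p.1.2) h)))

theorem Term.valueMap_injective {f g : Fin n → SyncTree A} {α : ∀ i, f i ⟶ g i}
    (hα : ∀ i, Function.Injective (Hom.toFun (α i)))
    (t : Term (Delta A) (fun _ : Fin n => 0) 0) :
    Function.Injective (Hom.toFun (t.valueMap (deltaTrees A) α)) := by
  induction t with
  | var i => exact i.elim0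
  | op σ ts ih =>
    cases σ with
    | plus => exact sumMap_injective (ih (0 : Fin 2)) (ih (1 : Fin 2))
    | times => exact prodMap_injective (ih (0 : Fin 2)) (ih (1 : Fin 2))
    | zero => exact fun _ _ h => h
    | one => exact fun _ _ h => h
    | letter c => exact fun _ _ h => h
  | app i ts => exact hα i

variable (rhs : Fin (n + 1) → Term (Delta A) (fun _ : Fin (n + 1) => 0) 0)

/-- The first map starts at a one-vertex tree, and the operations preserve injectivity. Hence the
approximations embed in the initial solution. -/
theorem regApproxMap_injective (k : ℕ) (i : Fin (n + 1)) :
    Function.Injective (Hom.toFun (regApproxMap (deltaTrees A) rhs k i)) := by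
  induction k generalizing i with
  | zero => exact fun _ _ _ => rfl
  | succ k ih => exact (rhs i).valueMap_injective ih

theorem trans_regChain_injective (i : Fin (n + 1)) {k l : ℕ} (h : k ≤ l) :
    Function.Injective (trans (regChain (deltaTrees A) rhs i) h) := by
  induction l, h using Nat.le_induction with
  | base =>
    intro x y e
    rwa [trans_refl, trans_refl] at e
  | succ l h ih =>
    intro x y e
    rw [← SyncTree.trans_trans _ h (Nat.le_succ l), ← SyncTree.trans_trans _ h (Nat.le_succ l)] at e
    refine ih (regApproxMap_injective rhs l i ?_)
    rwa [SyncTree.trans, Functor.ofSequence_map_homOfLE_succ] at e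

/-- The components of the initial solution of a regular scheme. -/
def regSol (i : Fin (n + 1)) : SyncTree A := chainColimit (regChain (deltaTrees A) rhs i)

/-- The morphisms from the approximations to the initial solution. -/
def regι (k : ℕ) (i : Fin (n + 1)) : regApprox (deltaTrees A) rhs k i ⟶ regSol rhs i :=
  (chainCocone (regChain (deltaTrees A) rhs i)).ι.app k

theorem regApproxMap_regι (k : ℕ) (i : Fin (n + 1)) :
    regApproxMap (deltaTrees A) rhs k i ≫ regι rhs (k + 1) i = regι rhs k i := by
  have := (chainCocone (regChain (deltaTrees A) rhs i)).w (homOfLE (Nat.le_succ k))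
  rwa [Functor.ofSequence_map_homOfLE_succ] at this

theorem regι_injective (k : ℕ) (i : Fin (n + 1)) :
    Function.Injective (Hom.toFun (regι rhs k i)) := by
  intro x y h
  obtain ⟨m, hm, e⟩ := chainCocone_injective _ h
  exact trans_regChain_injective rhs i hm e

theorem valueMap_regι_succ (k : ℕ) (t : Term (Delta A) (fun _ : Fin (n + 1) => 0) 0) :
    t.valueMap (deltaTrees A) (regApproxMap (deltaTrees A) rhs k) ≫
      t.valueMap (deltaTrees A) (regι rhs (k + 1)) = t.valueMap (deltaTrees A) (regι rhs k) := by
  rw [Term.valueMap_comp]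
  congr 1
  funext i
  exact regApproxMap_regι rhs k i

theorem exists_valueMap_regι_of_le {k l : ℕ} (h : k ≤ l)
    (t : Term (Delta A) (fun _ : Fin (n + 1) => 0) 0)
    (x : (t.value (deltaTrees A) (regApprox (deltaTrees A) rhs k)).V) :
    ∃ y, Hom.toFun (t.valueMap (deltaTrees A) (regι rhs l)) y =
      Hom.toFun (t.valueMap (deltaTrees A) (regι rhs k)) x := by
  induction l, h using Nat.le_induction with
  | base => exact ⟨x, rfl⟩
  | succ l h ih =>
    obtain ⟨y, hy⟩ := ih
    rw [← valueMap_regι_succ] at hy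
    exact ⟨_, hy⟩

theorem exists_regι_of_le {k l : ℕ} (h : k ≤ l) (i : Fin (n + 1))
    (x : (regApprox (deltaTrees A) rhs k i).V) :
    ∃ y, Hom.toFun (regι rhs l i) y = Hom.toFun (regι rhs k i) x :=
  exists_valueMap_regι_of_le rhs h (.app i Fin.elim0) x

/-- Continuity of the operations: a vertex of a sum or product is given by a pair of vertices, and
these come from a common finite stage. -/
theorem exists_valueMap_regι (t : Term (Delta A) (fun _ : Fin (n + 1) => 0) 0)
    (y : (t.value (deltaTrees A) (regSol rhs)).V) :
    ∃ k x, Hom.toFun (t.valueMap (deltaTrees A) (regι rhs k)) x = y := by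
  induction t with
  | var i => exact i.elim0
  | op σ ts ih =>
    cases σ with
    | plus =>
      obtain ⟨z, rfl⟩ | ⟨z, rfl⟩ := sum_cases y
      · obtain ⟨k, x, rfl⟩ := ih (0 : Fin 2) z
        exact ⟨k, Hom.toFun (inl _ _) x, congrFun (congrArg Hom.toFun (inl_sumMap _ _)) x⟩
      · obtain ⟨k, x, rfl⟩ := ih (1 : Fin 2) z
        exact ⟨k, Hom.toFun (inr _ _) x, congrFun (congrArg Hom.toFun (inr_sumMap _ _)) x⟩
    | times =>
      obtain ⟨⟨y, z⟩, h⟩ := y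
      obtain ⟨k, x, rfl⟩ := ih (0 : Fin 2) y
      obtain ⟨l, w, rfl⟩ := ih (1 : Fin 2) z
      obtain ⟨x', hx⟩ := exists_valueMap_regι_of_le rhs (le_max_left k l) _ x
      obtain ⟨w', hw⟩ := exists_valueMap_regι_of_le rhs (le_max_right k l) _ w
      refine ⟨max k l, ⟨(x', w'), ?_⟩, Subtype.ext (Prod.ext hx hw)⟩
      rw [← hx, ← hw] at h
      exact (Hom.isExitTarget_iff _ _).symm.trans (h.trans (Hom.map_ne_root_iff _ _))
    | zero => exact ⟨0, y, rfl⟩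
    | one => exact ⟨0, y, rfl⟩
    | letter c => exact ⟨0, y, rfl⟩
  | app i ts => exact chainCocone_surjective _ y

/-- The initial solution satisfies the equations. -/
theorem exists_regSol_iso (i : Fin (n + 1)) :
    ∃ e : regSol rhs i ≅ (rhs i).value (deltaTrees A) (regSol rhs), ∀ k,
      regι rhs (k + 1) i ≫ e.hom = (rhs i).valueMap (deltaTrees A) (regι rhs k) := by
  -- Stage `k + 1` of the component is the right-hand side evaluated at stage `k`, so each leg moves
  -- one stage forward first.
  let leg : ∀ k, regApprox (deltaTrees A) rhs k i ⟶ (rhs i).value (deltaTrees A) (regSol rhs) :=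
    fun k => regApproxMap (deltaTrees A) rhs k i ≫ (rhs i).valueMap (deltaTrees A) (regι rhs k)
  have hleg : ∀ k, leg (k + 1) = (rhs i).valueMap (deltaTrees A) (regι rhs k) := fun k =>
    valueMap_regι_succ rhs k (rhs i)
  let s : Cocone (regChain (deltaTrees A) rhs i) :=
    { pt := (rhs i).value (deltaTrees A) (regSol rhs)
      ι := NatTrans.ofSequence (G := (Functor.const ℕ).obj _) leg (fun k => by
        rw [Functor.ofSequence_map_homOfLE_succ, hleg]
        rfl) }
  let d : regSol rhs i ⟶ (rhs i).value (deltaTrees A) (regSol rhs) :=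
    (chainCoconeIsColimit (regChain (deltaTrees A) rhs i)).desc s
  have hd : ∀ k, regι rhs (k + 1) i ≫ d = (rhs i).valueMap (deltaTrees A) (regι rhs k) := fun k =>
    ((chainCoconeIsColimit (regChain (deltaTrees A) rhs i)).fac s (k + 1)).trans (hleg k)
  have hd' : ∀ k x, Hom.toFun d (Hom.toFun (regι rhs (k + 1) i) x) =
      Hom.toFun ((rhs i).valueMap (deltaTrees A) (regι rhs k)) x := fun k x =>
    congrFun (congrArg Hom.toFun (hd k)) x
  have hsurj : ∀ k, ∀ x : (regSol rhs i).V, ∃ l, ∃ y, k ≤ l ∧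
      Hom.toFun (regι rhs (l + 1) i) y = x := by
    intro k x
    obtain ⟨l, y, rfl⟩ := chainCocone_surjective _ x
    obtain ⟨z, hz⟩ := exists_regι_of_le rhs (show l ≤ max k l + 1 by omega) i y
    exact ⟨max k l, z, le_max_left _ _, hz⟩
  have hbij : Function.Bijective (Hom.toFun d) := by
    constructor
    · intro x y h
      obtain ⟨l, x, -, rfl⟩ := hsurj 0 x
      -- The second vertex is represented at a later stage than the first, so that both can be
      -- compared at stage `l' + 1`.
      obtain ⟨l', y, hl, rfl⟩ := hsurj (l + 1) y
      obtain ⟨z, hz⟩ := exists_regι_of_le rhs (show l + 1 ≤ l' + 1 by omega) i x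
      rw [← hz, hd', hd'] at h
      rw [← hz, (rhs i).valueMap_injective (regι_injective rhs l') h]
    · intro y
      obtain ⟨k, x, rfl⟩ := exists_valueMap_regι rhs (rhs i) y
      exact ⟨_, hd' k x⟩
  obtain ⟨e, he⟩ := exists_iso_of_bijective d hbij
  exact ⟨e, fun k => (congrArg _ he).trans (hd k)⟩

/-! ### Tracing the states `up m` to finitely many subterms -/

section Subterms

variable {rhs} {a b : A} {m : ℕ}

/-- Some term of `T` has a value whose root has the state `up m`. -/
def HasUpTerm (rhs : Fin (n + 1) → Term (Delta A) (fun _ : Fin (n + 1) => 0) 0) (a b : A) (m : ℕ)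
    (T : Set (Term (Delta A) (fun _ : Fin (n + 1) => 0) 0)) : Prop :=
  ∃ r ∈ T, HasState a b (r.value (deltaTrees A) (regSol rhs))
    (r.value (deltaTrees A) (regSol rhs)).root (.up m)

theorem HasUpTerm.mono {T T' : Set (Term (Delta A) (fun _ : Fin (n + 1) => 0) 0)}
    (h : HasUpTerm rhs a b m T) (hT : T ⊆ T') : HasUpTerm rhs a b m T' :=
  let ⟨r, h1, h2⟩ := h
  ⟨r, hT h1, h2⟩

theorem hasUpTerm_of_root {t : Term (Delta A) (fun _ : Fin (n + 1) => 0) 0} {k : ℕ}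
    {x : (t.value (deltaTrees A) (regApprox (deltaTrees A) rhs k)).V} (hx : x = SyncTree.root _)
    (h : HasState a b (t.value (deltaTrees A) (regSol rhs))
      (Hom.toFun (t.valueMap (deltaTrees A) (regι rhs k)) x) (.up m)) :
    HasUpTerm rhs a b m (t.subterms ∪ ⋃ i, (rhs i).subterms) := by
  subst hx
  rw [Hom.map_root] at h
  exact ⟨t, Or.inl t.mem_subterms, h⟩

/-- Structural induction on `t` at a fixed stage, with the function variables left to `happ`. Roots
are treated separately, as the root of a sum is not bisimilar to the root of a summand. -/
theorem hasUpTerm_of_app (hab : a ≠ b) (k : ℕ)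
    (happ : ∀ i (x : (regApprox (deltaTrees A) rhs k i).V),
      HasState a b (regSol rhs i) (Hom.toFun (regι rhs k i) x) (.up m) →
      HasUpTerm rhs a b m ({.app i Fin.elim0} ∪ ⋃ i, (rhs i).subterms))
    (t : Term (Delta A) (fun _ : Fin (n + 1) => 0) 0)
    (x : (t.value (deltaTrees A) (regApprox (deltaTrees A) rhs k)).V)
    (h : HasState a b (t.value (deltaTrees A) (regSol rhs))
      (Hom.toFun (t.valueMap (deltaTrees A) (regι rhs k)) x) (.up m)) :
    HasUpTerm rhs a b m (t.subterms ∪ ⋃ i, (rhs i).subterms) := by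
  by_cases hx : x = SyncTree.root _
  · exact hasUpTerm_of_root hx h
  induction t with
  | var i => exact i.elim0
  | op σ ts ih =>
    have ih' : ∀ j (y : ((ts j).value (deltaTrees A) (regApprox (deltaTrees A) rhs k)).V),
        HasState a b ((ts j).value (deltaTrees A) (regSol rhs))
          (Hom.toFun ((ts j).valueMap (deltaTrees A) (regι rhs k)) y) (.up m) →
        HasUpTerm rhs a b m ((Term.op σ ts).subterms ∪ ⋃ i, (rhs i).subterms) := by
      intro j y hy
      refine HasUpTerm.mono ?_ (Set.union_subset_union_left _ (Term.subterms_subset σ ts j))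
      by_cases hy' : y = SyncTree.root _
      · exact hasUpTerm_of_root hy' hy
      · exact ih j y hy hy'
    cases σ with
    | plus =>
      obtain ⟨y, rfl⟩ | ⟨y, rfl⟩ := sum_cases x
      · have hy : y ≠ SyncTree.root _ := fun h => hx (h ▸ Hom.map_root _)
        exact ih' (0 : Fin 2) y (h.of_isBisim (isBisim_inl _ _).symm
          ⟨Hom.map_ne_root _ hy, congrFun (congrArg Hom.toFun (inl_sumMap _ _)) y⟩)
      · have hy : y ≠ SyncTree.root _ := fun h => hx (h ▸ Hom.map_root _)
        exact ih' (1 : Fin 2) y (h.of_isBisim (isBisim_inr _ _).symm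
          ⟨Hom.map_ne_root _ hy, congrFun (congrArg Hom.toFun (inr_sumMap _ _)) y⟩)
    | times =>
      obtain ⟨⟨y, z⟩, hyz⟩ := x
      by_cases hz : z = SyncTree.root _
      · subst hz
        have hy : ¬ SyncTree.IsExitTarget _ y := fun h => hyz.1 h rfl
        have hy' := (not_congr (Hom.isExitTarget_iff
          ((ts (0 : Fin 2)).valueMap (deltaTrees A) (regι rhs k)) y)).2 hy
        have h' : HasState a b _ (prodLeft _ ((ts (1 : Fin 2)).value (deltaTrees A) (regSol rhs))
            (Hom.toFun ((ts (0 : Fin 2)).valueMap (deltaTrees A) (regι rhs k)) y) hy') (.up m) := by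
          refine Eq.subst (motive := fun p => HasState a b _ p _) ?_ h
          exact Subtype.ext (Prod.ext rfl
            (Hom.map_root ((ts (1 : Fin 2)).valueMap (deltaTrees A) (regι rhs k))))
        obtain h1 | h1 := h'.up_of_prodLeft hab
        · exact ih' (0 : Fin 2) y h1
        · refine ih' (1 : Fin 2) (SyncTree.root _) ?_
          rwa [Hom.map_root]
      · exact ih' (1 : Fin 2) z (h.of_isBisim (isBisim_prod_right _ _).symm
          ⟨Hom.map_ne_root _ hz, rfl⟩)
    | zero => exact absurd rfl hx
    | one =>
      -- A vertex in state `up m` has an `a`-edge, which no non-root vertex of `1` or of a letter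
      -- has.
      obtain ⟨y, ⟨h1, -⟩, -⟩ := h.step (.climb m)
      cases x
      · exact absurd rfl hx
      · cases h1
    | letter c =>
      obtain ⟨y, h1 | ⟨-, h1, -⟩, -⟩ := h.step (.climb m)
      · exact absurd h1.1 hx
      · cases h1
  | app i ts =>
    obtain rfl : ts = Fin.elim0 := Subsingleton.elim _ _
    exact happ i x h

/-- A state `up m` of a vertex of a regular tree is the state of the value of a subterm. -/
theorem hasUpTerm (hab : a ≠ b) (k : ℕ)
    (t : Term (Delta A) (fun _ : Fin (n + 1) => 0) 0)
    (x : (t.value (deltaTrees A) (regApprox (deltaTrees A) rhs k)).V)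
    (h : HasState a b (t.value (deltaTrees A) (regSol rhs))
      (Hom.toFun (t.valueMap (deltaTrees A) (regι rhs k)) x) (.up m)) :
    HasUpTerm rhs a b m (t.subterms ∪ ⋃ i, (rhs i).subterms) := by
  induction k generalizing t with
  | zero =>
    -- At stage `0` a function variable denotes a single vertex, so `x` is the root.
    exact hasUpTerm_of_app hab 0
      (fun i x h => hasUpTerm_of_root (t := .app i Fin.elim0) (k := 0) (x := x) rfl h) t x h
  | succ k ih =>
    refine hasUpTerm_of_app hab (k + 1) (fun i x h => ?_) t x h
    -- A vertex of component `i` at stage `k + 1` is a vertex of its right-hand side at stage `k`,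
    -- and the fixed-point isomorphism carries its state along.
    obtain ⟨e, he⟩ := exists_regSol_iso rhs i
    refine (ih (rhs i) x (h.of_isBisim (isBisim_iso e)
      (congrFun (congrArg Hom.toFun (he k)) x))).mono ?_
    exact Set.union_subset (fun r hr => Or.inr (Set.mem_iUnion.2 ⟨i, hr⟩)) Set.subset_union_right

end Subterms

theorem HasState.exists_up {a b : A} {t : SyncTree A} (h : HasState a b t t.root (.up 0)) (m : ℕ) :
    ∃ x, HasState a b t x (.up m) := by
  induction m with
  | zero => exact ⟨_, h⟩
  | succ m ih =>
    obtain ⟨x, hx⟩ := ih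
    obtain ⟨y, -, hy⟩ := hx.step (.climb m)
    exact ⟨y, hy⟩

/-- No `Δ`-regular tree is bisimilar to the state `up 0`. -/
theorem DeltaRegular.not_hasState {a b : A} (hab : a ≠ b) {t : SyncTree A} (ht : DeltaRegular t) :
    ¬ HasState a b t t.root (.up 0) := by
  intro h
  obtain ⟨n, rhs, s, ⟨hs⟩, ⟨e⟩⟩ := IsRegular.exists_regChain _ ht
  let e' : t ≅ regSol rhs 0 := e ≪≫ hs.coconePointUniqueUpToIso (chainCoconeIsColimit _)
  have h' := h.of_isBisim (isBisim_iso e') (Hom.map_root e'.hom)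
  let T : Set (Term (Delta A) (fun _ : Fin (n + 1) => 0) 0) :=
    (Term.app 0 Fin.elim0 : Term (Delta A) (fun _ : Fin (n + 1) => 0) 0).subterms ∪
      ⋃ i, (rhs i).subterms
  have hT : T.Finite :=
    (Term.subterms_finite _).union (Set.finite_iUnion fun i => (rhs i).subterms_finite)
  have hup : ∀ m, HasUpTerm rhs a b m T := by
    intro m
    obtain ⟨x, hx⟩ := HasState.exists_up h' m
    obtain ⟨k, y, rfl⟩ := chainCocone_surjective _ x
    exact hasUpTerm hab k (.app 0 Fin.elim0) y hx
  choose r hrT hr using hup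
  have := hT.to_subtype
  -- Pigeonhole: infinitely many states `up m`, finitely many subterms.
  obtain ⟨m, m', hne, heq⟩ := Finite.exists_ne_map_eq_of_infinite fun m => (⟨r m, hrT m⟩ : T)
  have heq' : r m = r m' := congrArg Subtype.val heq
  have h1 := hr m
  rw [heq'] at h1
  exact hne (h1.up_unique hab (hr m'))

end RecScheme

theorem mainTheorem7 {A : Type u} (a b : A) (hab : a ≠ b) :
    (∃ T : RecScheme.SyncTree A,
      (RecScheme.abScheme a b).Defines (RecScheme.gammaTrees A) T ∧
      RecScheme.GammaAlgebraic T ∧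
      ∀ t : RecScheme.SyncTree A, RecScheme.DeltaRegular t → ¬ T.Bisimilar t) ∧
    {t : RecScheme.SyncTree A | ∃ s, RecScheme.DeltaRegular s ∧ t.Bisimilar s} ⊂
      {t : RecScheme.SyncTree A | ∃ s, RecScheme.GammaAlgebraic s ∧ t.Bisimilar s} ∧
    {t : RecScheme.SyncTree A | ∃ s, RecScheme.DeltaRegular s ∧ Nonempty (t ≅ s)} ⊂
      {t : RecScheme.SyncTree A | ∃ s, RecScheme.GammaAlgebraic s ∧ Nonempty (t ≅ s)} := by
  obtain ⟨T, hT, hs⟩ := RecScheme.SyncTree.exists_abScheme_defines hab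
  have hΓ : RecScheme.GammaAlgebraic T := ⟨_, hT⟩
  have hΔ : ∀ t : RecScheme.SyncTree A, RecScheme.DeltaRegular t → ¬ T.Bisimilar t := by
    rintro t ht ⟨R, h0, hR⟩
    exact ht.not_hasState hab (hs.of_isBisim hR h0)
  refine ⟨⟨T, hT, hΓ, hΔ⟩, (Set.ssubset_iff_of_subset ?_).2 ⟨T, ?_, ?_⟩,
    (Set.ssubset_iff_of_subset ?_).2 ⟨T, ?_, ?_⟩⟩
  · rintro t ⟨s, h, h'⟩
    exact ⟨s, h.gammaAlgebraic, h'⟩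
  · exact ⟨T, hΓ, .of_iso (Iso.refl _)⟩
  · rintro ⟨s, h, h'⟩
    exact hΔ s h h'
  · rintro t ⟨s, h, h'⟩
    exact ⟨s, h.gammaAlgebraic, h'⟩
  · exact ⟨T, hΓ, ⟨Iso.refl _⟩⟩
  · rintro ⟨s, h, ⟨e⟩⟩
    exact hΔ s h (.of_iso e)
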